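/- **Setting.** For every sample size $n\ge 1$ let $(Y_i,\mathbf X_i)$, $i=1,\dots,n$, be i.i.d. observations with $Y_i\in\mathbb R$, $\mathbf X_i\in\mathbb R^{d}$, $d=d_n\ge 1$, from the linear model $Y_i=\mathbf X_i^T\beta^*+\varepsilon_i$ with $\mathbb E\,\varepsilon_i=0$; the dimension $d$, the parameter $\beta^*=(\theta^*,\gamma^{*T})^T\in\mathbb R\times\mathbb R^{d-1}$ and the distribution of $(Y_i,\mathbf X_i)$ may all depend on $n$. Let $\mathbb X\in\mathbb R^{n\times d}$ be the matrix with rows $\mathbf X_i^T$, $Y=(Y_1,\dots,Y_n)^T$, $\Sigma_n=n^{-1}\mathbb X^T\mathbb X$, $\Sigma_X=n^{-1}\mathbb E\,\mathbb X^T\mathbb X$, $e_1=(1,0,\dots,0)^T$, $v^*=\Sigma_X^{-1}e_1$, $s=\|\beta^*\|_0$, $s_v=\|v^*\|_0$ (numbers of nonzero entries), and $\|Z\|_{\psi_2}=\sup_{p\ge 1}p^{-1/2}(\mathbb E|Z|^p)^{1/p}$. Let $\Phi$ be the standard normal distribution function. **Assumptions.** For constants $K,K_X,M,C_\varepsilon,\delta>0$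 not depending on $n$, and all $n\ge1$: $\|\varepsilon_i\|_{\psi_2}\le K$; $\max_{1\le j\le d}\|X_{ij}\|_{\psi_2}\le K_X$; $\varepsilon_i$ and $\mathbf X_i$ are independent; $\operatorname{Var}(\varepsilon_i)\ge C_\varepsilon$; $\lambda_{\min}(\Sigma_X)\ge\delta$; $\|v^*\|_1\le M$. Moreover, as $n\to\infty$, $$\max(s_v,s)\,\frac{\log d}{\sqrt n}=o(1),\qquad \sqrt{\frac{\log d}{n}}=o(1).$$ **Estimators.** With tuning parameters $\lambda=\lambda_n$, $\lambda'=\lambda'_n$, let $\hat\beta=(\hat\theta,\hat\gamma^T)^T$ and $\hat v$ be any (measurable) choices of solutions of $$\hat\beta\in\arg\min\|\beta\|_1\ \text{ subject to }\ \|n^{-1}\mathbb X^T(\mathbb X\beta-Y)\|_\infty\le\lambda,\qquad \hat v\in\arg\min\|v\|_1\ \text{ subject to }\ \|v^T\Sigma_n-e_1^T\|_\infty\le\lambda',$$ and let $\tilde\theta$ be a (measurable) solution in $\theta$ of $\hat S(\theta,\hat\gamma)=0$, where $\hat S(\beta)=n^{-1}\hat v^T\mathbb X^T(\mathbb X\beta-Y)$.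 Each of $\hat\beta,\hat v,\tilde\theta$ may be arbitrary where the problem defining it has no solution. Put $$\hat\Delta=\hat v^T\Sigma_n\hat v\cdot n^{-1}\sum_{i=1}^n(Y_i-\mathbf X_i^T\hat\beta)^2,\qquad \hat U_n=\hat\Delta^{-1/2}\,n^{1/2}(\tilde\theta-\theta^*).$$ **Claim.** There is a constant $A_0>0$, depending only on $K$, $K_X$ and $M$, such that, under the above assumptions (for any $C_\varepsilon,\delta>0$), if for some constant $A$ and all sufficiently large $n$ $$A_0\sqrt{\frac{\log d}{n}}\le\lambda\le A\sqrt{\frac{\log d}{n}},\qquad A_0\sqrt{\frac{\log d}{n}}\le\lambda'\le A\sqrt{\frac{\log d}{n}},$$ then for every $t\in\mathbb R$ $$\lim_{n\to\infty}\bigl|\mathbb P(\hat U_n\le t)-\Phi(t)\bigr|=0 .$$ -/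

import Mathlib

open MeasureTheory ProbabilityTheory Filter Topology
open scoped Matrix ENNReal

noncomputable section

/-- The norm `‖f‖_{ψ_l} = sup_{p ≥ 1} p^{-1/l} (E|f|^p)^{1/p}`, with values in `[0, ∞]`. -/
def psiNorm {Ω : Type*} [MeasurableSpace Ω] (l : ℝ) (f : Ω → ℝ) (P : Measure Ω) : ℝ≥0∞ :=
  ⨆ p : {p : ℝ // 1 ≤ p},
    ENNReal.ofReal ((p : ℝ) ^ (-1 / l)) * eLpNorm f (ENNReal.ofReal (p : ℝ)) P

/-- The `ℓ¹` norm. The `ℓ^∞` norm is Mathlib's norm on `Fin d → ℝ`, and the number of nonzero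
entries is Mathlib's `hammingNorm`. -/
def l1Norm {d : ℕ} (v : Fin d → ℝ) : ℝ := ∑ j, |v j|

/-- The unit vector `e_1`; the first coordinate has index `0`. -/
def e1 (d : ℕ) [NeZero d] : Fin d → ℝ := Pi.single 0 1

/-- The residual `Y - X β` of a coefficient vector; at the true parameter it is the error. -/
def modelResidual {n d : ℕ} (X : Matrix (Fin n) (Fin d) ℝ) (Y : Fin n → ℝ) (β : Fin d → ℝ) :
    Fin n → ℝ := Y - X *ᵥ β

/-- `Σ_n = n⁻¹ Xᵀ X`. -/
def sampleSecondMoment {n d : ℕ} (X : Matrix (Fin n) (Fin d) ℝ) : Matrix (Fin d) (Fin d) ℝ :=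
  (n : ℝ)⁻¹ • (Xᵀ * X)

/-- `Σ_X = n⁻¹ E[Xᵀ X]`, for a random design matrix `X`. -/
def secondMoment {n d : ℕ} {Ω : Type*} [MeasurableSpace Ω] (P : Measure Ω)
    (X : Ω → Matrix (Fin n) (Fin d) ℝ) : Matrix (Fin d) (Fin d) ℝ :=
  Matrix.of fun j k => (n : ℝ)⁻¹ * ∫ ω, ((X ω)ᵀ * X ω) j k ∂P

/-- `v* = Σ_X⁻¹ e_1`. -/
def vStar {n d : ℕ} [NeZero d] {Ω : Type*} [MeasurableSpace Ω] (P : Measure Ω)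
    (X : Ω → Matrix (Fin n) (Fin d) ℝ) : Fin d → ℝ :=
  (secondMoment P X)⁻¹ *ᵥ e1 d

/-- The estimating equation `t((Y, X), β) = n⁻¹ Xᵀ (X β - Y)`. -/
def estEq {n d : ℕ} (X : Matrix (Fin n) (Fin d) ℝ) (Y : Fin n → ℝ) (β : Fin d → ℝ) :
    Fin d → ℝ :=
  (n : ℝ)⁻¹ • (Xᵀ *ᵥ (X *ᵥ β - Y))

/-- `b` is a minimizer of the `ℓ¹` norm over `S`. -/
def IsL1Argmin {d : ℕ} (S : Set (Fin d → ℝ)) (b : Fin d → ℝ) : Prop :=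
  b ∈ S ∧ ∀ b' ∈ S, l1Norm b ≤ l1Norm b'

/-- The constraint set `‖n⁻¹ Xᵀ (X β - Y)‖_∞ ≤ lam` of the Dantzig selector. -/
def dantzigSet {n d : ℕ} (X : Matrix (Fin n) (Fin d) ℝ) (Y : Fin n → ℝ) (lam : ℝ) :
    Set (Fin d → ℝ) :=
  {β | ‖estEq X Y β‖ ≤ lam}

/-- The constraint set `‖vᵀ Σ_n - e_1‖_∞ ≤ lam'` of the projection direction. -/
def projectionSet {n d : ℕ} [NeZero d] (X : Matrix (Fin n) (Fin d) ℝ) (lam' : ℝ) :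
    Set (Fin d → ℝ) :=
  {v | ‖v ᵥ* sampleSecondMoment X - e1 d‖ ≤ lam'}

/-- The projected equation `Ŝ(β) = n⁻¹ vᵀ Xᵀ (X β - Y)` along the direction `v`. -/
def projEq {n d : ℕ} (X : Matrix (Fin n) (Fin d) ℝ) (Y : Fin n → ℝ) (v β : Fin d → ℝ) : ℝ :=
  v ⬝ᵥ estEq X Y β

/-- `θ` solves `Ŝ(θ, γ) = 0`, where `γ` consists of all entries of `β` but the first. -/
def IsZRoot {n d : ℕ} [NeZero d] (X : Matrix (Fin n) (Fin d) ℝ) (Y : Fin n → ℝ)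
    (v β : Fin d → ℝ) (θ : ℝ) : Prop :=
  projEq X Y v (Function.update β 0 θ) = 0

/-- The variance estimator `Δ̂ = vᵀ Σ_n v · n⁻¹ ∑ᵢ (Yᵢ - Xᵢᵀ β)²`. -/
def deltaHat {n d : ℕ} (X : Matrix (Fin n) (Fin d) ℝ) (Y : Fin n → ℝ) (v β : Fin d → ℝ) : ℝ :=
  (v ⬝ᵥ (sampleSecondMoment X *ᵥ v)) * ((n : ℝ)⁻¹ * ∑ i, (modelResidual X Y β i) ^ 2)

/-- The studentized statistic `Û_n = Δ̂^{-1/2} n^{1/2} (θ - θ*)`. -/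
def studentized {n d : ℕ} (X : Matrix (Fin n) (Fin d) ℝ) (Y : Fin n → ℝ) (v β : Fin d → ℝ)
    (θ θstar : ℝ) : ℝ :=
  (√(deltaHat X Y v β))⁻¹ * √(n : ℝ) * (θ - θstar)

/-- The linear model `Yᵢ = Xᵢᵀ β* + εᵢ` for an i.i.d. sample of size `n`, whose centered errors are
sub-Gaussian, have variance at least `Cε` and are independent of the design, and whose design is
coordinatewise sub-Gaussian with all eigenvalues of the second moment matrix at least `δ`.
The row `X ω i` is the `i`-th covariate. -/
structure LinearModel {n d : ℕ} {Ω : Type*} [MeasurableSpace Ω] (P : Measure Ω)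
    (X : Ω → Matrix (Fin n) (Fin d) ℝ) (Y : Ω → Fin n → ℝ) (βstar : Fin d → ℝ)
    (K KX Cε δ : ℝ) : Prop where
  indep : iIndepFun (fun (i : Fin n) (ω : Ω) => ((X ω i : Fin d → ℝ), Y ω i)) P
  identDistrib : ∀ i j : Fin n, IdentDistrib (fun ω => ((X ω i : Fin d → ℝ), Y ω i))
    (fun ω => ((X ω j : Fin d → ℝ), Y ω j)) P P
  error_mean : ∀ i : Fin n, ∫ ω, modelResidual (X ω) (Y ω) βstar i ∂P = 0
  error_indep_design : ∀ i : Fin n,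
    IndepFun (fun ω => modelResidual (X ω) (Y ω) βstar i) (fun ω => (X ω i : Fin d → ℝ)) P
  error_subGaussian : ∀ i : Fin n,
    psiNorm 2 (fun ω => modelResidual (X ω) (Y ω) βstar i) P ≤ ENNReal.ofReal K
  design_subGaussian : ∀ (i : Fin n) (j : Fin d),
    psiNorm 2 (fun ω => X ω i j) P ≤ ENNReal.ofReal KX
  error_variance : ∀ i : Fin n, Cε ≤ variance (fun ω => modelResidual (X ω) (Y ω) βstar i) P
  eigenvalue_ge : ∀ μ ∈ spectrum ℝ (secondMoment P X), δ ≤ μ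

end

/-! ### Sparse vectors, restricted strong convexity and score identities. -/

section Deterministic

variable {d : ℕ}

/-! Since the estimating equation is affine in β and `v ᵥ* Σ_n = e1 + w` with `w` small in sup norm,
projecting along `v` almost removes the nuisance coordinates. The root therefore satisfies `(θ - θ*)
(1 + w 0) = v* ⬝ᵥ H` up to a remainder, where `H` is the noise score; the remainder pairs ℓ¹ errors
of the two estimators with sup-norm bounds (`projEq_update`, `abs_sub_noise_le_of_isZRoot`). Both ℓ¹
errors are of order `k * g`, with `k` a sparsity level and `g` a deviation level, so after scaling
the remainder is of order `√n * k * g ^ 2`, which the sparsity assumption sends to zero.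

The rates are deterministic on a `GoodSample`: an ℓ¹ minimizer differs from a feasible sparse target
by a vector in a cone, on which the eigenvalue bound for `Σ_X` transfers to any entrywise close
matrix (`l1Norm_sub_sq_le`, `quadForm_ge_of_close`, `estimator_rates`). Exponential moments of
products, Chernoff's bound and a union bound make good samples likely
(`LinearModel.measureReal_not_goodSample_le`).

The leading term `√n * (v* ⬝ᵥ H)` is a normalized i.i.d. sum of variance `v* 0` times the error
variance, bounded away from zero. Its fourth moments are bounded through `‖v*‖₁` alone, whence the
central limit theorem for arrays. On the good event the variance estimator has the same limiting
size, and `tendsto_measureReal_le_of_close` plays the role of Slutsky's theorem.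

One difficulty is that `d` need not tend to infinity, and may even be 1, so a union bound at level
`√(log d / n)` need not have small failure probability. For each tolerance a cutoff `D` is fixed.
Above it the logarithmic level works and the true parameters are feasible. Below it the level is `T
/ √n`; the targets may then be infeasible, but `Σ_n` is invertible, which makes both programs
feasible, and the bounded dimension replaces sparsity. The cutoff may vary with the tolerance
because `A₀` does not depend on it. -/

lemma l1Norm_nonneg (v : Fin d → ℝ) : 0 ≤ l1Norm v :=
  Finset.sum_nonneg fun _ _ => abs_nonneg _

lemma abs_le_l1Norm (v : Fin d → ℝ) (j : Fin d) : |v j| ≤ l1Norm v :=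
  Finset.single_le_sum (f := fun j => |v j|) (fun _ _ => abs_nonneg _) (Finset.mem_univ j)

lemma l1Norm_le_add_l1Norm_sub (v w : Fin d → ℝ) : l1Norm w ≤ l1Norm v + l1Norm (w - v) := by
  unfold l1Norm
  rw [← Finset.sum_add_distrib]
  refine Finset.sum_le_sum fun j _ => ?_
  have := abs_add_le (v j) (w j - v j)
  simpa using this

lemma abs_dotProduct_le_of_forall {x y : Fin d → ℝ} {b : ℝ} (hy : ∀ j, |y j| ≤ b) :
    |x ⬝ᵥ y| ≤ l1Norm x * b := by
  unfold l1Norm dotProduct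
  rw [Finset.sum_mul]
  refine (Finset.abs_sum_le_sum_abs _ _).trans (Finset.sum_le_sum fun j _ => ?_)
  rw [abs_mul]
  exact mul_le_mul_of_nonneg_left (hy j) (abs_nonneg _)

lemma abs_le_of_norm_le {y : Fin d → ℝ} {b : ℝ} (hy : ‖y‖ ≤ b) (j : Fin d) : |y j| ≤ b :=
  (norm_le_pi_norm y j).trans hy

lemma dotProduct_self_eq_sum_sq (x : Fin d → ℝ) : x ⬝ᵥ x = ∑ j, x j ^ 2 := by
  simp [dotProduct, sq]

lemma dotProduct_self_nonneg' (x : Fin d → ℝ) : 0 ≤ x ⬝ᵥ x := by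
  rw [dotProduct_self_eq_sum_sq]; positivity

lemma sq_sum_abs_le (s : Finset (Fin d)) (x : Fin d → ℝ) :
    (∑ j ∈ s, |x j|) ^ 2 ≤ s.card * (x ⬝ᵥ x) := by
  have h := sq_sum_le_card_mul_sum_sq (s := s) (f := fun j => |x j|)
  refine h.trans (mul_le_mul_of_nonneg_left ?_ (Nat.cast_nonneg _))
  rw [dotProduct_self_eq_sum_sq]
  simp only [sq_abs]
  exact Finset.sum_le_sum_of_subset_of_nonneg (Finset.subset_univ _) fun _ _ _ => sq_nonneg _

lemma l1Norm_sq_le_card (x : Fin d → ℝ) : l1Norm x ^ 2 ≤ d * (x ⬝ᵥ x) := by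
  simpa [l1Norm] using sq_sum_abs_le Finset.univ x

/-- The cone condition: a vector of smaller `ℓ¹` norm than a sparse vector differs from it by an
approximately sparse vector. -/
lemma l1Norm_sub_sq_le {b b' : Fin d → ℝ} (h : l1Norm b' ≤ l1Norm b) :
    l1Norm (b' - b) ^ 2 ≤ 4 * hammingNorm b * ((b' - b) ⬝ᵥ (b' - b)) := by
  classical
  set S : Finset (Fin d) := Finset.univ.filter fun j => b j ≠ 0 with hS
  have hcard : (S.card : ℝ) = hammingNorm b := by simp [hS, hammingNorm]
  have hT : l1Norm (b' - b) ≤ 2 * ∑ j ∈ S, |(b' - b) j| := by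
    -- Equality off the support of `b`, the triangle inequality on it. Summed, and with `h`, this
    -- bounds the whole ℓ¹ error by twice its part on the support.
    have key : ∀ j, |(b' - b) j| + |b j| ≤ |b' j| + if j ∈ S then 2 * |(b' - b) j| else 0 := by
      intro j
      by_cases hj : b j = 0
      · simp [hS, hj]
      · have h1 : |b j| ≤ |b' j| + |b' j - b j| := by
          have := abs_sub_abs_le_abs_sub (b j) (b' j)
          rw [abs_sub_comm] at this
          linarith
        simp only [hS, Finset.mem_filter, Finset.mem_univ, true_and, ne_eq, hj, not_false_eq_true,
          if_true, Pi.sub_apply]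
        linarith
    have hsum := Finset.sum_le_sum fun j (_ : j ∈ Finset.univ) => key j
    rw [Finset.sum_add_distrib, Finset.sum_add_distrib, Finset.sum_ite_mem, Finset.univ_inter,
      ← Finset.mul_sum] at hsum
    unfold l1Norm at h ⊢
    linarith
  calc l1Norm (b' - b) ^ 2 ≤ (2 * ∑ j ∈ S, |(b' - b) j|) ^ 2 :=
        pow_le_pow_left₀ (l1Norm_nonneg _) hT 2
    _ = 4 * (∑ j ∈ S, |(b' - b) j|) ^ 2 := by ring
    _ ≤ 4 * (S.card * ((b' - b) ⬝ᵥ (b' - b))) := by gcongr; exact sq_sum_abs_le S _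
    _ = _ := by rw [hcard]; ring

lemma abs_mulVec_le {B : Matrix (Fin d) (Fin d) ℝ} {ρ : ℝ} (hB : ∀ j k, |B j k| ≤ ρ)
    (x : Fin d → ℝ) (j : Fin d) : |(B *ᵥ x) j| ≤ l1Norm x * ρ := by
  rw [Matrix.mulVec, dotProduct_comm]
  exact abs_dotProduct_le_of_forall (hB j)

lemma abs_quadForm_le {B : Matrix (Fin d) (Fin d) ℝ} {ρ : ℝ} (hB : ∀ j k, |B j k| ≤ ρ)
    (x : Fin d → ℝ) : |x ⬝ᵥ (B *ᵥ x)| ≤ ρ * l1Norm x ^ 2 := by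
  refine (abs_dotProduct_le_of_forall (abs_mulVec_le hB x)).trans_eq ?_
  ring

/-- Restricted strong convexity passes from `S` to an entrywise close matrix `Q`. -/
lemma quadForm_ge_of_close {S Q : Matrix (Fin d) (Fin d) ℝ} {δ ρ k : ℝ} {x : Fin d → ℝ}
    (hρ0 : 0 ≤ ρ) (hS : δ * (x ⬝ᵥ x) ≤ x ⬝ᵥ (S *ᵥ x)) (hQ : ∀ j l, |(Q - S) j l| ≤ ρ)
    (hk : l1Norm x ^ 2 ≤ 4 * k * (x ⬝ᵥ x)) (hρ : 4 * k * ρ ≤ δ / 2) :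
    δ / 2 * (x ⬝ᵥ x) ≤ x ⬝ᵥ (Q *ᵥ x) := by
  have h1 := abs_quadForm_le hQ x
  rw [Matrix.sub_mulVec, dotProduct_sub] at h1
  have h2 := (abs_le.1 h1).1
  have h3 : ρ * l1Norm x ^ 2 ≤ δ / 2 * (x ⬝ᵥ x) := by
    calc ρ * l1Norm x ^ 2 ≤ ρ * (4 * k * (x ⬝ᵥ x)) := by gcongr
      _ = (4 * k * ρ) * (x ⬝ᵥ x) := by ring
      _ ≤ _ := mul_le_mul_of_nonneg_right hρ (dotProduct_self_nonneg' x)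
  linarith

/-- The quadratic form is at least `δ / 2` times the squared ℓ² norm and at most `μ` times the ℓ¹
norm. The cone condition turns ℓ² back into ℓ¹, and one factor of the ℓ¹ norm cancels. -/
lemma l1Norm_le_of_mulVec_le {S Q : Matrix (Fin d) (Fin d) ℝ} {δ ρ k μ : ℝ} {x : Fin d → ℝ}
    (hδ : 0 < δ) (hk0 : 0 ≤ k) (hμ : 0 ≤ μ)
    (hρ0 : 0 ≤ ρ) (hS : δ * (x ⬝ᵥ x) ≤ x ⬝ᵥ (S *ᵥ x)) (hQ : ∀ j l, |(Q - S) j l| ≤ ρ)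
    (hk : l1Norm x ^ 2 ≤ 4 * k * (x ⬝ᵥ x)) (hρ : 4 * k * ρ ≤ δ / 2)
    (hQx : ∀ j, |(Q *ᵥ x) j| ≤ μ) : l1Norm x ≤ 8 * k * μ / δ := by
  have h1 := quadForm_ge_of_close hρ0 hS hQ hk hρ
  have h2 : x ⬝ᵥ (Q *ᵥ x) ≤ l1Norm x * μ := (le_abs_self _).trans (abs_dotProduct_le_of_forall hQx)
  have h3 : x ⬝ᵥ x ≤ 2 / δ * (l1Norm x * μ) := by
    rw [div_mul_eq_mul_div, le_div_iff₀ hδ]; linarith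
  have h4 : l1Norm x ^ 2 ≤ l1Norm x * (8 * k * μ / δ) := by
    calc l1Norm x ^ 2 ≤ 4 * k * (x ⬝ᵥ x) := hk
      _ ≤ 4 * k * (2 / δ * (l1Norm x * μ)) := by gcongr
      _ = _ := by ring
  rcases (l1Norm_nonneg x).eq_or_lt with h0 | h0
  · rw [← h0]; positivity
  · rw [sq] at h4
    exact le_of_mul_le_mul_left h4 h0

/-- By Cauchy–Schwarz every vector satisfies the cone condition with `k = d`, so strong convexity
passes to `Q` on the whole space and makes it injective. -/
lemma isUnit_of_close {S Q : Matrix (Fin d) (Fin d) ℝ} {δ ρ : ℝ} (hδ : 0 < δ) (hρ0 : 0 ≤ ρ)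
    (hS : ∀ x : Fin d → ℝ, δ * (x ⬝ᵥ x) ≤ x ⬝ᵥ (S *ᵥ x)) (hQ : ∀ j l, |(Q - S) j l| ≤ ρ)
    (hρ : 4 * d * ρ ≤ δ / 2) : IsUnit Q := by
  rw [← Matrix.mulVec_injective_iff_isUnit]
  intro x y hxy
  have h0 : Q *ᵥ (x - y) = 0 := by rw [Matrix.mulVec_sub]; exact sub_eq_zero.2 hxy
  have hk : l1Norm (x - y) ^ 2 ≤ 4 * d * ((x - y) ⬝ᵥ (x - y)) :=
    (l1Norm_sq_le_card _).trans (by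
      have := mul_nonneg (Nat.cast_nonneg (α := ℝ) d) (dotProduct_self_nonneg' (x - y))
      linarith)
  have h1 := quadForm_ge_of_close hρ0 (hS (x - y)) hQ hk hρ
  rw [h0, dotProduct_zero] at h1
  have h2 : (x - y) ⬝ᵥ (x - y) = 0 :=
    le_antisymm (by nlinarith) (dotProduct_self_nonneg' _)
  exact sub_eq_zero.1 (dotProduct_self_eq_zero.1 h2)

variable {n : ℕ}

lemma transpose_sampleSecondMoment (X : Matrix (Fin n) (Fin d) ℝ) :
    (sampleSecondMoment X)ᵀ = sampleSecondMoment X := by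
  simp [sampleSecondMoment, Matrix.transpose_mul]

lemma vecMul_sampleSecondMoment (X : Matrix (Fin n) (Fin d) ℝ) (v : Fin d → ℝ) :
    v ᵥ* sampleSecondMoment X = sampleSecondMoment X *ᵥ v := by
  conv_lhs => rw [← transpose_sampleSecondMoment, Matrix.vecMul_transpose]

/-- The score at the true parameter, with the sign of the errors: `n⁻¹ Xᵀ ε`. -/
noncomputable def noiseScore (X : Matrix (Fin n) (Fin d) ℝ) (ε : Fin n → ℝ) : Fin d → ℝ :=
  (n : ℝ)⁻¹ • (Xᵀ *ᵥ ε)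

lemma noiseScore_apply (X : Matrix (Fin n) (Fin d) ℝ) (ε : Fin n → ℝ) (j : Fin d) :
    noiseScore X ε j = (n : ℝ)⁻¹ * ∑ i, X i j * ε i := by
  simp [noiseScore, Matrix.mulVec, dotProduct]

lemma sampleSecondMoment_apply (X : Matrix (Fin n) (Fin d) ℝ) (j k : Fin d) :
    sampleSecondMoment X j k = (n : ℝ)⁻¹ * ∑ i, X i j * X i k := by
  simp [sampleSecondMoment, Matrix.mul_apply]

lemma estEq_eq (X : Matrix (Fin n) (Fin d) ℝ) (Y : Fin n → ℝ) (β βstar : Fin d → ℝ) :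
    estEq X Y β = sampleSecondMoment X *ᵥ (β - βstar)
      - noiseScore X (modelResidual X Y βstar) := by
  unfold estEq sampleSecondMoment noiseScore modelResidual
  rw [Matrix.smul_mulVec, ← smul_sub, ← Matrix.mulVec_mulVec, ← Matrix.mulVec_sub,
    Matrix.mulVec_sub X]
  congr 2
  abel

/-- Expanding the square gives a quadratic form minus twice a noise term, which is exactly the
estimating equation minus the noise score, paired with `β - βstar`. Both vectors are small in sup
norm, so an ℓ¹ rate suffices. -/
lemma mean_residual_sq (X : Matrix (Fin n) (Fin d) ℝ) (Y : Fin n → ℝ) (β βstar : Fin d → ℝ) :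
    (n : ℝ)⁻¹ * ∑ i, modelResidual X Y β i ^ 2 =
      (n : ℝ)⁻¹ * ∑ i, modelResidual X Y βstar i ^ 2 +
        (β - βstar) ⬝ᵥ (estEq X Y β - noiseScore X (modelResidual X Y βstar)) := by
  set ε := modelResidual X Y βstar with hε
  have hr : modelResidual X Y β = ε - X *ᵥ (β - βstar) := by
    simp only [hε, modelResidual, Matrix.mulVec_sub]; abel
  rw [estEq_eq X Y β βstar, ← hε]
  have ht : ∀ w, (β - βstar) ⬝ᵥ (Xᵀ *ᵥ w) = (X *ᵥ (β - βstar)) ⬝ᵥ w := fun w => by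
    rw [Matrix.dotProduct_mulVec, Matrix.vecMul_transpose]
  simp only [← dotProduct_self_eq_sum_sq, hr, noiseScore, sampleSecondMoment, Matrix.smul_mulVec,
    dotProduct_sub, dotProduct_smul, ← Matrix.mulVec_mulVec, ht, smul_eq_mul, sub_dotProduct]
  rw [dotProduct_comm ε (X *ᵥ (β - βstar))]
  ring

end Deterministic

/-! ### Expansion of the one-step estimator. -/

section Expansion

variable {n d : ℕ} [NeZero d]

lemma dotProduct_e1 (u : Fin d → ℝ) : u ⬝ᵥ e1 d = u 0 := by
  simp [e1]

lemma l1Norm_update_zero_le (b : Fin d → ℝ) : l1Norm (Function.update b 0 0) ≤ l1Norm b := by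
  refine Finset.sum_le_sum fun j _ => ?_
  by_cases hj : j = 0
  · subst hj; simp
  · simp [hj]

/-- The error of the updated vector splits into a nuisance part with zero first entry and a multiple
of `e1`. In `v ᵥ* Σ_n = e1 + w` the summand `e1` annihilates the nuisance part, which therefore
enters only through `w`; this is the orthogonality behind debiasing. -/
lemma projEq_update (X : Matrix (Fin n) (Fin d) ℝ) (Y : Fin n → ℝ) (v β βstar : Fin d → ℝ)
    (θ : ℝ) :
    projEq X Y v (Function.update β 0 θ) =
      (v ᵥ* sampleSecondMoment X - e1 d) ⬝ᵥ Function.update (β - βstar) 0 0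
        + (θ - βstar 0) * (1 + (v ᵥ* sampleSecondMoment X - e1 d) 0)
        - v ⬝ᵥ noiseScore X (modelResidual X Y βstar) := by
  have h1 : Function.update β 0 θ - βstar
      = Function.update (β - βstar) 0 0 + (θ - βstar 0) • e1 d := by
    ext j
    by_cases hj : j = 0
    · subst hj; simp [e1]
    · simp [hj, e1]
  have h2 : e1 d ⬝ᵥ Function.update (β - βstar) 0 0 = 0 := by
    rw [dotProduct_comm, dotProduct_e1]; simp
  rw [projEq, estEq_eq X Y _ βstar, dotProduct_sub, Matrix.dotProduct_mulVec, h1, dotProduct_add,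
    dotProduct_smul, dotProduct_e1, sub_dotProduct, h2]
  simp [e1]

/-- The equation is affine in `θ` with slope `1 + w 0`; the base point `0` for the expansion is
arbitrary. -/
lemma exists_isZRoot (X : Matrix (Fin n) (Fin d) ℝ) (Y : Fin n → ℝ) (v β : Fin d → ℝ)
    (h : 1 + (v ᵥ* sampleSecondMoment X - e1 d) 0 ≠ 0) : ∃ θ, IsZRoot X Y v β θ := by
  refine ⟨(v ⬝ᵥ noiseScore X (modelResidual X Y 0) -
    (v ᵥ* sampleSecondMoment X - e1 d) ⬝ᵥ Function.update (β - 0) 0 0) /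
      (1 + (v ᵥ* sampleSecondMoment X - e1 d) 0), ?_⟩
  rw [IsZRoot, projEq_update X Y v β 0]
  simp only [Pi.zero_apply, sub_zero]
  rw [div_mul_cancel₀ _ h]
  ring

/-- Linearization of the one-step estimator. -/
lemma abs_sub_noise_le_of_isZRoot {X : Matrix (Fin n) (Fin d) ℝ} {Y : Fin n → ℝ}
    {v β βstar vstar : Fin d → ℝ} {θ u L ev eb : ℝ} (h : IsZRoot X Y v β θ)
    (hu : ∀ j, |noiseScore X (modelResidual X Y βstar) j| ≤ u) (hu0 : 0 ≤ u)
    (hL : ∀ j, |(v ᵥ* sampleSecondMoment X - e1 d) j| ≤ L) (hL0 : 0 ≤ L)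
    (hv : l1Norm (v - vstar) ≤ ev) (hb : l1Norm (β - βstar) ≤ eb) :
    |(θ - βstar 0) * (1 + (v ᵥ* sampleSecondMoment X - e1 d) 0)
      - vstar ⬝ᵥ noiseScore X (modelResidual X Y βstar)| ≤ ev * u + eb * L := by
  rw [IsZRoot, projEq_update X Y v β βstar] at h
  set w := v ᵥ* sampleSecondMoment X - e1 d
  set H := noiseScore X (modelResidual X Y βstar)
  have h1 : (θ - βstar 0) * (1 + w 0) - vstar ⬝ᵥ H
      = (v - vstar) ⬝ᵥ H - Function.update (β - βstar) 0 0 ⬝ᵥ w := by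
    rw [sub_dotProduct, dotProduct_comm _ w]; linarith
  rw [h1]
  have h2 := abs_dotProduct_le_of_forall (x := v - vstar) hu
  have h3 := abs_dotProduct_le_of_forall (x := Function.update (β - βstar) 0 0) hL
  have h4 := (l1Norm_update_zero_le (β - βstar)).trans hb
  have h5 := mul_le_mul_of_nonneg_right hv hu0
  have h6 := mul_le_mul_of_nonneg_right h4 hL0
  exact (abs_sub _ _).trans (by linarith)

/-- Substituting `Σ_n v = e1 + w` leaves `v 0 + v ⬝ᵥ w`, so the quadratic form is controlled by the
constraint and the ℓ¹ rate, with no separate comparison of `Σ_n` with its mean. -/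
lemma abs_quadForm_sub_le {X : Matrix (Fin n) (Fin d) ℝ}
    {v vstar : Fin d → ℝ} {L ev M : ℝ}
    (hL : ∀ j, |(v ᵥ* sampleSecondMoment X - e1 d) j| ≤ L) (hL0 : 0 ≤ L)
    (hv : l1Norm (v - vstar) ≤ ev) (hM : l1Norm vstar ≤ M) :
    |v ⬝ᵥ (sampleSecondMoment X *ᵥ v) - vstar 0| ≤ ev + (M + ev) * L := by
  have h1 : v ⬝ᵥ (sampleSecondMoment X *ᵥ v) - vstar 0
      = (v - vstar) 0 + v ⬝ᵥ (v ᵥ* sampleSecondMoment X - e1 d) := by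
    rw [dotProduct_sub, dotProduct_e1, vecMul_sampleSecondMoment]
    simp
  rw [h1]
  have h2 := abs_dotProduct_le_of_forall (x := v) hL
  have h3 := (abs_le_l1Norm (v - vstar) 0).trans hv
  have h4 := (l1Norm_le_add_l1Norm_sub vstar v).trans (add_le_add hM hv)
  have h5 := mul_le_mul_of_nonneg_right h4 hL0
  exact (abs_add_le _ _).trans (by linarith)

end Expansion

/-! ### Feasibility and rates for the two ℓ¹ programs. -/

section Estimators

variable {n d : ℕ}

lemma abs_mean_residual_sq_sub_le {X : Matrix (Fin n) (Fin d) ℝ} {Y : Fin n → ℝ}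
    {β βstar : Fin d → ℝ} {u L eb : ℝ}
    (hu : ∀ j, |noiseScore X (modelResidual X Y βstar) j| ≤ u) (hu0 : 0 ≤ u)
    (hL : ∀ j, |estEq X Y β j| ≤ L) (hL0 : 0 ≤ L) (hb : l1Norm (β - βstar) ≤ eb) :
    |(n : ℝ)⁻¹ * ∑ i, modelResidual X Y β i ^ 2
      - (n : ℝ)⁻¹ * ∑ i, modelResidual X Y βstar i ^ 2| ≤ eb * (L + u) := by
  rw [mean_residual_sq X Y β βstar, add_sub_cancel_left]
  refine (abs_dotProduct_le_of_forall (b := L + u) fun j => ?_).trans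
    (mul_le_mul_of_nonneg_right hb (add_nonneg hL0 hu0))
  exact (abs_sub _ _).trans (add_le_add (hL j) (hu j))

/-- `ℓ¹` error of an `ℓ¹`-minimizer, when the target is feasible. -/
lemma l1Norm_sub_le_of_feasible {X : Matrix (Fin n) (Fin d) ℝ} {S : Matrix (Fin d) (Fin d) ℝ}
    {F : Set (Fin d → ℝ)} {b b' : Fin d → ℝ} {δ ρ k μ : ℝ}
    (hδ : 0 < δ) (hμ : 0 ≤ μ) (hρ0 : 0 ≤ ρ)
    (hS : ∀ x : Fin d → ℝ, δ * (x ⬝ᵥ x) ≤ x ⬝ᵥ (S *ᵥ x))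
    (hQ : ∀ j l, |(sampleSecondMoment X - S) j l| ≤ ρ)
    (hk : (hammingNorm b : ℝ) ≤ k) (hρ : 4 * k * ρ ≤ δ / 2)
    (hb : b ∈ F) (hb' : IsL1Argmin F b')
    (hQx : ∀ j, |(sampleSecondMoment X *ᵥ (b' - b)) j| ≤ μ) :
    l1Norm (b' - b) ≤ 8 * k * μ / δ := by
  refine l1Norm_le_of_mulVec_le hδ ((Nat.cast_nonneg _).trans hk) hμ hρ0 (hS _) hQ ?_ hρ hQx
  refine (l1Norm_sub_sq_le (hb'.2 b hb)).trans ?_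
  have := dotProduct_self_nonneg' (b' - b)
  gcongr

/-- `ℓ¹` error of an approximate solution of a linear system, in bounded dimension. -/
lemma l1Norm_sub_le_of_dim {X : Matrix (Fin n) (Fin d) ℝ} {S : Matrix (Fin d) (Fin d) ℝ}
    {x : Fin d → ℝ} {δ ρ k μ : ℝ}
    (hδ : 0 < δ) (hμ : 0 ≤ μ) (hρ0 : 0 ≤ ρ)
    (hS : ∀ x : Fin d → ℝ, δ * (x ⬝ᵥ x) ≤ x ⬝ᵥ (S *ᵥ x))
    (hQ : ∀ j l, |(sampleSecondMoment X - S) j l| ≤ ρ)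
    (hk : (d : ℝ) ≤ k) (hρ : 4 * k * ρ ≤ δ / 2)
    (hQx : ∀ j, |(sampleSecondMoment X *ᵥ x) j| ≤ μ) :
    l1Norm x ≤ 8 * k * μ / δ := by
  have hk0 : 0 ≤ k := (Nat.cast_nonneg _).trans hk
  refine l1Norm_le_of_mulVec_le hδ hk0 hμ hρ0 (hS _) hQ ?_ hρ hQx
  refine (l1Norm_sq_le_card x).trans ?_
  have := dotProduct_self_nonneg' x
  have : (d : ℝ) ≤ 4 * k := by linarith
  gcongr

/-- Solving the normal equations exactly gives a feasible point even at `lam = 0`. This is needed in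
bounded dimension, where the tuning parameter may lie below the noise level and vanishes when `d =
1`. -/
lemma dantzigSet_nonempty_of_isUnit {X : Matrix (Fin n) (Fin d) ℝ} (Y : Fin n → ℝ) {lam : ℝ}
    (hlam : 0 ≤ lam) (h : IsUnit (sampleSecondMoment X)) : (dantzigSet X Y lam).Nonempty := by
  obtain ⟨b, hb⟩ := (Matrix.mulVec_surjective_iff_isUnit.2 h)
    (noiseScore X (modelResidual X Y 0))
  refine ⟨b, ?_⟩
  change ‖estEq X Y b‖ ≤ lam
  rw [estEq_eq X Y b 0, sub_zero, hb, sub_self, norm_zero]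
  exact hlam

lemma projectionSet_nonempty_of_isUnit [NeZero d] {X : Matrix (Fin n) (Fin d) ℝ} {lam : ℝ}
    (hlam : 0 ≤ lam) (h : IsUnit (sampleSecondMoment X)) : (projectionSet X lam).Nonempty := by
  obtain ⟨b, hb⟩ := (Matrix.mulVec_surjective_iff_isUnit.2 h) (e1 d)
  refine ⟨b, ?_⟩
  change ‖b ᵥ* sampleSecondMoment X - e1 d‖ ≤ lam
  rw [vecMul_sampleSecondMoment, hb, sub_self, norm_zero]
  exact hlam

/-- The design and the noise deviate from their means by at most `u`. -/
structure GoodSample (X : Matrix (Fin n) (Fin d) ℝ) (ε : Fin n → ℝ)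
    (S : Matrix (Fin d) (Fin d) ℝ) (u : ℝ) : Prop where
  noise : ∀ j, |noiseScore X ε j| ≤ u
  design : ∀ j l, |(sampleSecondMoment X - S) j l| ≤ u

lemma abs_mulVec_sub_e1_le [NeZero d] {X : Matrix (Fin n) (Fin d) ℝ} {ε : Fin n → ℝ}
    {S : Matrix (Fin d) (Fin d) ℝ} {u M : ℝ} (h : GoodSample X ε S u) (hu : 0 ≤ u)
    {v : Fin d → ℝ} (hSv : S *ᵥ v = e1 d) (hM : l1Norm v ≤ M) (j : Fin d) :
    |(sampleSecondMoment X *ᵥ v - e1 d) j| ≤ M * u := by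
  rw [← hSv, ← Matrix.sub_mulVec]
  exact (abs_mulVec_le h.design v j).trans (mul_le_mul_of_nonneg_right hM hu)

/-- Feasibility of both programs and `ℓ¹` rates for both estimators on a good sample. -/
lemma estimator_rates [NeZero d] {X : Matrix (Fin n) (Fin d) ℝ} {Y : Fin n → ℝ}
    {S : Matrix (Fin d) (Fin d) ℝ} {βstar vstar β v : Fin d → ℝ}
    {δ u k g M L lam lam' : ℝ} (hδ : 0 < δ) (hu : 0 ≤ u) (hM0 : 0 ≤ M)
    (hS : ∀ x : Fin d → ℝ, δ * (x ⬝ᵥ x) ≤ x ⬝ᵥ (S *ᵥ x)) (hSv : S *ᵥ vstar = e1 d)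
    (hM : l1Norm vstar ≤ M) (hgood : GoodSample X (modelResidual X Y βstar) S u)
    (hlam0 : 0 ≤ lam) (hlam0' : 0 ≤ lam') (hlam : lam ≤ L) (hlam' : lam' ≤ L)
    (hg : L + (1 + M) * u ≤ g) (hkg : 4 * k * g ≤ δ / 2)
    (hcase : (d : ℝ) ≤ k ∨ ((hammingNorm vstar : ℝ) ≤ k ∧ (hammingNorm βstar : ℝ) ≤ k ∧
      u ≤ lam ∧ M * u ≤ lam'))
    (hβ : (dantzigSet X Y lam).Nonempty → IsL1Argmin (dantzigSet X Y lam) β)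
    (hv : (projectionSet X lam').Nonempty → IsL1Argmin (projectionSet X lam') v) :
    (∀ j, |estEq X Y β j| ≤ L) ∧ (∀ j, |(v ᵥ* sampleSecondMoment X - e1 d) j| ≤ L) ∧
      l1Norm (β - βstar) ≤ 16 * k * g / δ ∧ l1Norm (v - vstar) ≤ 16 * k * g / δ := by
  have hMu : 0 ≤ M * u := mul_nonneg hM0 hu
  have hL0 : 0 ≤ L := hlam0.trans hlam
  have hug : u ≤ g := by nlinarith
  have hk0 : 0 ≤ k := by
    rcases hcase with h | h
    · exact (Nat.cast_nonneg _).trans h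
    · exact (Nat.cast_nonneg _).trans h.1
  have hkρ : 4 * k * u ≤ δ / 2 :=
    (mul_le_mul_of_nonneg_left hug (by positivity)).trans hkg
  have hdim : (d : ℝ) ≤ k → IsUnit (sampleSecondMoment X) := fun hdk => by
    refine isUnit_of_close hδ hu hS hgood.design (le_trans ?_ hkρ)
    gcongr
  have hβne : (dantzigSet X Y lam).Nonempty := by
    rcases hcase with h | h
    · exact dantzigSet_nonempty_of_isUnit Y hlam0 (hdim h)
    · refine ⟨βstar, ?_⟩
      change ‖estEq X Y βstar‖ ≤ lam
      rw [estEq_eq X Y βstar βstar, sub_self, Matrix.mulVec_zero, zero_sub, norm_neg]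
      exact (pi_norm_le_iff_of_nonneg hlam0).2 fun j => (hgood.noise j).trans h.2.2.1
  have hvfeas : M * u ≤ lam' → vstar ∈ projectionSet X lam' := fun h => by
    change ‖vstar ᵥ* sampleSecondMoment X - e1 d‖ ≤ lam'
    rw [vecMul_sampleSecondMoment]
    exact (pi_norm_le_iff_of_nonneg hlam0').2 fun j =>
      (abs_mulVec_sub_e1_le hgood hu hSv hM j).trans h
  have hvne : (projectionSet X lam').Nonempty := by
    rcases hcase with h | h
    · exact projectionSet_nonempty_of_isUnit hlam0' (hdim h)
    · exact ⟨vstar, hvfeas h.2.2.2⟩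
  have hβ1 : ∀ j, |estEq X Y β j| ≤ L := fun j =>
    (abs_le_of_norm_le (hβ hβne).1 j).trans hlam
  have hv1 : ∀ j, |(v ᵥ* sampleSecondMoment X - e1 d) j| ≤ L := fun j =>
    (abs_le_of_norm_le (hv hvne).1 j).trans hlam'
  have hβ2 : ∀ j, |(sampleSecondMoment X *ᵥ (β - βstar)) j| ≤ 2 * g := fun j => by
    have h1 : (sampleSecondMoment X *ᵥ (β - βstar)) j
        = estEq X Y β j + noiseScore X (modelResidual X Y βstar) j := by
      rw [estEq_eq X Y β βstar]; simp
    rw [h1]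
    have := (abs_add_le _ _).trans (add_le_add (hβ1 j) (hgood.noise j))
    linarith
  have hv2 : ∀ j, |(sampleSecondMoment X *ᵥ (v - vstar)) j| ≤ 2 * g := fun j => by
    have h1 : (sampleSecondMoment X *ᵥ (v - vstar)) j
        = (v ᵥ* sampleSecondMoment X - e1 d) j - (sampleSecondMoment X *ᵥ vstar - e1 d) j := by
      rw [vecMul_sampleSecondMoment, Matrix.mulVec_sub]; simp
    rw [h1]
    have := (abs_sub _ _).trans
      (add_le_add (hv1 j) (abs_mulVec_sub_e1_le hgood hu hSv hM j))
    linarith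
  have hg0 : 0 ≤ 2 * g := by linarith
  have e16 : 16 * k * g / δ = 8 * k * (2 * g) / δ := by ring
  refine ⟨hβ1, hv1, ?_, ?_⟩ <;> rw [e16] <;> rcases hcase with h | h
  · exact l1Norm_sub_le_of_dim hδ hg0 hu hS hgood.design h hkρ hβ2
  · refine l1Norm_sub_le_of_feasible hδ hg0 hu hS hgood.design h.2.1 hkρ ?_ (hβ hβne) hβ2
    change ‖estEq X Y βstar‖ ≤ lam
    rw [estEq_eq X Y βstar βstar, sub_self, Matrix.mulVec_zero, zero_sub, norm_neg]
    exact (pi_norm_le_iff_of_nonneg hlam0).2 fun j => (hgood.noise j).trans h.2.2.1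
  · exact l1Norm_sub_le_of_dim hδ hg0 hu hS hgood.design h hkρ hv2
  · exact l1Norm_sub_le_of_feasible hδ hg0 hu hS hgood.design h.1 hkρ (hvfeas h.2.2.2)
      (hv hvne) hv2

end Estimators

/-! ### Replacing the estimated variance by its limit. -/

section Studentization

/-- The factor `(1 + w) * √(A * B) / √(v * s)` exchanges the estimated scale for the true one and
inserts the slope of the projected equation. It is close to one because `|√q - 1| ≤ |q - 1|` for
positive `q`. -/
lemma studentization_factor {A B v s w ζ a : ℝ} (hv : 0 < v) (hs : 0 < s)
    (hA : |A / v - 1| ≤ ζ) (hB : |B / s - 1| ≤ ζ) (hw : |w| ≤ ζ) (hζ : ζ ≤ 1 / 2) :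
    (√(A * B))⁻¹ * a * ((1 + w) * (√(A * B) / √(v * s))) = a * (1 + w) / √(v * s) ∧
      |(1 + w) * (√(A * B) / √(v * s)) - 1| ≤ 7 * ζ ∧ 0 ≤ (1 + w) * (√(A * B) / √(v * s)) := by
  have hζ0 : 0 ≤ ζ := (abs_nonneg _).trans hw
  rw [abs_le] at hA hB hw
  have hx : 0 < A / v := by linarith
  have hy : 0 < B / s := by linarith
  have hA0 : 0 < A := by simpa [div_mul_cancel₀ _ hv.ne'] using mul_pos hx hv
  have hB0 : 0 < B := by simpa [div_mul_cancel₀ _ hs.ne'] using mul_pos hy hs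
  have hAB : 0 < √(A * B) := Real.sqrt_pos.2 (mul_pos hA0 hB0)
  have hvs : 0 < √(v * s) := Real.sqrt_pos.2 (mul_pos hv hs)
  refine ⟨by field_simp, ?_, mul_nonneg (by linarith) (by positivity)⟩
  have hq : √(A * B) / √(v * s) = √(A / v * (B / s)) := by
    rw [← Real.sqrt_div (mul_pos hA0 hB0).le, div_mul_div_comm]
  rw [hq]
  set x := A / v
  set y := B / s
  have hxy : |x * y - 1| ≤ 3 * ζ := by
    rw [abs_le]; constructor <;> nlinarith
  have hq2 : |√(x * y) - 1| ≤ 3 * ζ := by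
    refine le_trans ?_ hxy
    have h0 := Real.sqrt_nonneg (x * y)
    have h1 : x * y - 1 = (√(x * y) - 1) * (√(x * y) + 1) := by
      have := Real.sq_sqrt (mul_pos hx hy).le
      linear_combination -this
    rw [h1, abs_mul, abs_of_pos (by linarith : 0 < √(x * y) + 1)]
    exact le_mul_of_one_le_right (abs_nonneg _) (by linarith)
  rw [abs_le] at hq2 ⊢
  constructor <;> nlinarith

/-- On a good sample the studentized statistic is, up to a factor close to one and a small error,
the normalized noise average along `v*`. -/
lemma exists_studentized_close {δ M κ Cε : ℝ} (hδ : 0 < δ) (hM0 : 0 ≤ M) (hκ : 0 < κ)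
    (hCε : 0 < Cε) : ∃ C : ℝ, 0 < C ∧ ∀ {n d : ℕ} [NeZero d] {X : Matrix (Fin n) (Fin d) ℝ}
    {Y : Fin n → ℝ} {S : Matrix (Fin d) (Fin d) ℝ} {βstar vstar β v : Fin d → ℝ}
    {u k g L lam lam' s2 τ θ : ℝ}, 0 ≤ u →
    (∀ x : Fin d → ℝ, δ * (x ⬝ᵥ x) ≤ x ⬝ᵥ (S *ᵥ x)) → S *ᵥ vstar = e1 d →
    l1Norm vstar ≤ M → GoodSample X (modelResidual X Y βstar) S u →
    0 ≤ lam → 0 ≤ lam' → lam ≤ L → lam' ≤ L → L + (1 + M) * u ≤ g → 4 * k * g ≤ δ / 2 →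
    ((d : ℝ) ≤ k ∨ ((hammingNorm vstar : ℝ) ≤ k ∧ (hammingNorm βstar : ℝ) ≤ k ∧
      u ≤ lam ∧ M * u ≤ lam')) →
    ((dantzigSet X Y lam).Nonempty → IsL1Argmin (dantzigSet X Y lam) β) →
    ((projectionSet X lam').Nonempty → IsL1Argmin (projectionSet X lam') v) →
    ((∃ θ, IsZRoot X Y v β θ) → IsZRoot X Y v β θ) →
    κ ≤ vstar 0 → Cε ≤ s2 → |(n : ℝ)⁻¹ * ∑ i, modelResidual X Y βstar i ^ 2 - s2| ≤ τ →
    g ≤ τ → k * g ≤ τ → √n * (k * g ^ 2) ≤ τ → τ ≤ 1 → C * τ ≤ 1 →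
    ∃ R, 0 ≤ R ∧ |R - 1| ≤ C * τ ∧ |studentized X Y v β θ (βstar 0) * R -
      √n * (vstar ⬝ᵥ noiseScore X (modelResidual X Y βstar)) / √(vstar 0 * s2)| ≤ C * τ := by
  -- `32 / δ + M + 2` absorbs the absolute errors of both variance factors, division by `κ` or `Cε`
  -- makes them relative, and the final `1` covers `w`. The extra summand in the witness below pays
  -- for the linearization remainder.
  set C1 := (32 / δ + M + 2) * (1 / κ + 1 / Cε) + 1 with hC1
  refine ⟨7 * C1 + 16 / δ / √(κ * Cε), by positivity, ?_⟩
  intro n d _ X Y S βstar vstar β v u k g L lam lam' s2 τ θ hu hS hSv hM hgood hlam0 hlam0' hlam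
    hlam' hg hkg hcase hβ hv hθ hv0 hs2 hmean hgτ hkgτ hnτ hτ1 hCτ
  obtain ⟨hβ1, hv1, hβ2, hv2⟩ := estimator_rates hδ hu hM0 hS hSv hM hgood hlam0 hlam0' hlam hlam'
    hg hkg hcase hβ hv
  have hL0 : 0 ≤ L := hlam0.trans hlam
  have hMu : 0 ≤ M * u := mul_nonneg hM0 hu
  have hg0 : 0 ≤ g := by linarith
  have hτ0 : 0 ≤ τ := hg0.trans hgτ
  have hk0 : 0 ≤ k := by
    rcases hcase with h | h
    · exact (Nat.cast_nonneg _).trans h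
    · exact (Nat.cast_nonneg _).trans h.1
  set e := 16 * k * g / δ with he
  have he0 : 0 ≤ e := by positivity
  have heτ : e ≤ 16 / δ * τ := by
    rw [he, show 16 * k * g / δ = 16 / δ * (k * g) by ring]
    gcongr
  set w := (v ᵥ* sampleSecondMoment X - e1 d) 0 with hw
  have hC1pos : 0 < 1 / κ + 1 / Cε := by positivity
  have hsq : 0 < √(κ * Cε) := Real.sqrt_pos.2 (by positivity)
  have h7 : 7 * (C1 * τ) ≤ (7 * C1 + 16 / δ / √(κ * Cε)) * τ := by
    have : 0 ≤ 16 / δ / √(κ * Cε) * τ := by positivity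
    linarith
  have hζ : C1 * τ ≤ 1 / 2 := by linarith
  have hζ1 : τ ≤ C1 * τ := by
    have : 0 ≤ (32 / δ + M + 2) * (1 / κ + 1 / Cε) * τ := by positivity
    rw [hC1]; linarith
  have hwτ : |w| ≤ C1 * τ := (hv1 0).trans (by linarith)
  have hv0pos : 0 < vstar 0 := hκ.trans_le hv0
  have hs2pos : 0 < s2 := hCε.trans_le hs2
  have hratio : ∀ a b c : ℝ, 0 < b → 0 < c → c ≤ b → 1 / c ≤ 1 / κ + 1 / Cε →
      |a - b| ≤ (32 / δ + M + 2) * τ → |a / b - 1| ≤ C1 * τ := by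
    intro a b c hb hc hcb hc1 hab
    have h1 : a / b - 1 = (a - b) / b := by field_simp
    rw [h1, abs_div, abs_of_pos hb]
    calc |a - b| / b ≤ (32 / δ + M + 2) * τ / c := by gcongr
      _ = (32 / δ + M + 2) * (1 / c) * τ := by ring
      _ ≤ (32 / δ + M + 2) * (1 / κ + 1 / Cε) * τ := by gcongr
      _ ≤ C1 * τ := by rw [hC1]; linarith
  have hA : |v ⬝ᵥ (sampleSecondMoment X *ᵥ v) / vstar 0 - 1| ≤ C1 * τ := by
    refine hratio _ _ κ hv0pos hκ hv0 (by simp [hCε.le]) ?_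
    refine (abs_quadForm_sub_le hv1 hL0 hv2 hM).trans ?_
    have hLτ : L ≤ τ := by linarith
    have h1 : M * L ≤ M * τ := by gcongr
    have h2 : e * L ≤ e * 1 := by gcongr; linarith
    have h3 : 32 / δ * τ = 2 * (16 / δ * τ) := by ring
    linarith
  have hB : |((n : ℝ)⁻¹ * ∑ i, modelResidual X Y β i ^ 2) / s2 - 1| ≤ C1 * τ := by
    refine hratio _ _ Cε hs2pos hCε hs2 (by simp [hκ.le]) ?_
    have h1 := abs_mean_residual_sq_sub_le hgood.noise hu hβ1 hL0 hβ2
    have h2 := (abs_sub_le _ _ _).trans (add_le_add h1 hmean)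
    have h3 : e * (L + u) ≤ e * 1 := by gcongr; linarith
    have h4 : 32 / δ * τ = 2 * (16 / δ * τ) := by ring
    have h5 : 0 ≤ 16 / δ * τ := by positivity
    have h6 : 0 ≤ M * τ := by positivity
    linarith
  obtain ⟨f1, f2, f3⟩ := studentization_factor (a := √n * (θ - βstar 0)) hv0pos hs2pos hA hB hwτ hζ
  refine ⟨_, f3, f2.trans h7, ?_⟩
  have hw0 : 1 + w ≠ 0 := by
    have := (abs_le.1 hwτ).1
    intro h0
    linarith
  have hroot := hθ (exists_isZRoot X Y v β hw0)
  have hlin := abs_sub_noise_le_of_isZRoot hroot hgood.noise hu hv1 hL0 hv2 hβ2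
  rw [studentized, deltaHat, mul_assoc _ (√(n : ℝ)), f1, ← sub_div, abs_div,
    abs_of_pos (Real.sqrt_pos.2 (mul_pos hv0pos hs2pos))]
  have hnum : |√n * (θ - βstar 0) * (1 + w) -
      √n * (vstar ⬝ᵥ noiseScore X (modelResidual X Y βstar))| ≤ 16 / δ * τ := by
    rw [mul_assoc, ← mul_sub, abs_mul, abs_of_nonneg (Real.sqrt_nonneg _)]
    calc √n * |(θ - βstar 0) * (1 + w) - vstar ⬝ᵥ noiseScore X (modelResidual X Y βstar)|
        ≤ √n * (e * g) := by
          refine mul_le_mul_of_nonneg_left (hlin.trans ?_) (Real.sqrt_nonneg _)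
          rw [← mul_add]
          gcongr
          linarith
      _ = 16 / δ * (√n * (k * g ^ 2)) := by rw [he]; ring
      _ ≤ 16 / δ * τ := by gcongr
  calc _ ≤ 16 / δ * τ / √(κ * Cε) := by
        gcongr
    _ = 16 / δ / √(κ * Cε) * τ := by ring
    _ ≤ _ := by
        have : 0 ≤ 7 * C1 * τ := by positivity
        linarith

end Studentization

/-! ### Exponential moments and Chernoff bounds. -/

section Tails

variable {Ω : Type*} [MeasurableSpace Ω] {P : Measure Ω}

/-- A crude Stirling bound: `p ^ p / p!` is one term of the series for `exp p`. -/
lemma pow_self_le_exp_mul_factorial (p : ℕ) : (p : ℝ) ^ p ≤ Real.exp 1 ^ p * p.factorial := by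
  have h := Real.pow_div_factorial_le_exp (x := p) (Nat.cast_nonneg _) p
  rw [div_le_iff₀ (by positivity)] at h
  rwa [← Real.exp_nat_mul, mul_one]

lemma lintegral_pow_le_of_psiNorm {Z : Ω → ℝ} {K : ℝ} (hK : 0 < K)
    (hZ : psiNorm 2 Z P ≤ ENNReal.ofReal K) {p : ℕ} (hp : 1 ≤ p) :
    ∫⁻ ω, ENNReal.ofReal (Z ω ^ (2 * p)) ∂P ≤ ENNReal.ofReal ((2 * K ^ 2 * p) ^ p) := by
  have hp0 : (0 : ℝ) < 2 * p := by positivity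
  have h1p : (1 : ℝ) ≤ 2 * p := by
    have : (1 : ℝ) ≤ p := by exact_mod_cast hp
    linarith
  have h1 := (le_iSup (fun q : {q : ℝ // 1 ≤ q} => ENNReal.ofReal ((q : ℝ) ^ (-1 / 2 : ℝ)) *
    eLpNorm Z (ENNReal.ofReal (q : ℝ)) P) ⟨2 * p, h1p⟩).trans hZ
  simp only at h1
  rw [eLpNorm_eq_lintegral_rpow_enorm_toReal (by simpa using Nat.pos_iff_ne_zero.1 hp) ENNReal.ofReal_ne_top,
    ENNReal.toReal_ofReal hp0.le] at h1
  set I := ∫⁻ ω, ‖Z ω‖ₑ ^ (2 * (p : ℝ)) ∂P with hI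
  have hI' : ∫⁻ ω, ENNReal.ofReal (Z ω ^ (2 * p)) ∂P = I := by
    refine lintegral_congr fun ω => ?_
    rw [← Real.enorm_of_nonneg (by rw [pow_mul]; positivity), enorm_pow,
      show (2 * (p : ℝ)) = ((2 * p : ℕ) : ℝ) by push_cast; ring, ENNReal.rpow_natCast]
  rw [hI']
  have h2 : I ^ (1 / (2 * (p : ℝ))) ≤ ENNReal.ofReal (K * √(2 * p)) := by
    have hs : ENNReal.ofReal ((2 * (p : ℝ)) ^ (-1 / 2 : ℝ)) * ENNReal.ofReal (√(2 * p)) = 1 := by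
      rw [← ENNReal.ofReal_mul (by positivity), Real.sqrt_eq_rpow, ← Real.rpow_add hp0]
      norm_num
    calc I ^ (1 / (2 * (p : ℝ)))
        = ENNReal.ofReal (√(2 * p)) * (ENNReal.ofReal ((2 * (p : ℝ)) ^ (-1 / 2 : ℝ)) *
            I ^ (1 / (2 * (p : ℝ)))) := by rw [← mul_assoc, mul_comm _ (ENNReal.ofReal (_ ^ _)), hs, one_mul]
      _ ≤ ENNReal.ofReal (√(2 * p)) * ENNReal.ofReal K := by gcongr
      _ = _ := by rw [mul_comm, ENNReal.ofReal_mul hK.le]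
  calc I = (I ^ (1 / (2 * (p : ℝ)))) ^ (2 * (p : ℝ)) := by
        rw [← ENNReal.rpow_mul, one_div_mul_cancel hp0.ne', ENNReal.rpow_one]
    _ ≤ ENNReal.ofReal (K * √(2 * p)) ^ (2 * (p : ℝ)) := by gcongr
    _ = ENNReal.ofReal ((2 * K ^ 2 * p) ^ p) := by
        rw [show (2 * (p : ℝ)) = ((2 * p : ℕ) : ℝ) by push_cast; ring, ENNReal.rpow_natCast,
          ← ENNReal.ofReal_pow (by positivity), pow_mul, mul_pow K, Real.sq_sqrt (by positivity)]
        congr 2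
        push_cast
        ring

/-- A bound on the exponential moment of a square. -/
structure ExpSqBound (a : ℝ) (Z : Ω → ℝ) (P : Measure Ω) : Prop where
  aemeasurable : AEMeasurable Z P
  integrable : Integrable (fun ω => Real.exp (a * Z ω ^ 2)) P
  integral_le : ∫ ω, Real.exp (a * Z ω ^ 2) ∂P ≤ 2

/-- In the power series of the exponential, the moment bound and Stirling make the `p`-th term at
most `(2 * e * a * K ^ 2) ^ p ≤ 2⁻ᵖ`, and these sum to 2. Working with `lintegral` permits termwise
integration before integrability is known. -/
lemma expSqBound_of_psiNorm [IsProbabilityMeasure P] {Z : Ω → ℝ} {K a : ℝ} (hK : 0 < K)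
    (hm : AEMeasurable Z P) (hZ : psiNorm 2 Z P ≤ ENNReal.ofReal K) (ha0 : 0 ≤ a)
    (ha : a * (4 * Real.exp 1 * K ^ 2) ≤ 1) : ExpSqBound a Z P := by
  have hterm : ∀ p : ℕ, ∫⁻ ω, ENNReal.ofReal ((a * Z ω ^ 2) ^ p / p.factorial) ∂P
      ≤ ENNReal.ofReal ((1 / 2) ^ p) := by
    intro p
    rcases Nat.eq_zero_or_pos p with rfl | hp
    · simp
    · have h1 : ∀ ω, ENNReal.ofReal ((a * Z ω ^ 2) ^ p / p.factorial)
          = ENNReal.ofReal (a ^ p / p.factorial) * ENNReal.ofReal (Z ω ^ (2 * p)) := fun ω => by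
        rw [← ENNReal.ofReal_mul (by positivity), mul_pow, pow_mul]
        congr 1; ring
      simp_rw [h1]
      rw [lintegral_const_mul' _ _ ENNReal.ofReal_ne_top]
      refine (mul_le_mul_right (lintegral_pow_le_of_psiNorm hK hZ hp) _).trans ?_
      rw [← ENNReal.ofReal_mul (by positivity)]
      refine ENNReal.ofReal_le_ofReal ?_
      rw [mul_pow _ (p : ℝ), div_mul_eq_mul_div, div_le_iff₀ (by positivity)]
      calc a ^ p * ((2 * K ^ 2) ^ p * (p : ℝ) ^ p)
          ≤ a ^ p * ((2 * K ^ 2) ^ p * (Real.exp 1 ^ p * p.factorial)) := by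
            gcongr; exact pow_self_le_exp_mul_factorial p
        _ = (a * (2 * K ^ 2) * Real.exp 1) ^ p * p.factorial := by rw [mul_pow, mul_pow]; ring
        _ ≤ (1 / 2) ^ p * p.factorial := by
            gcongr
            linarith
  have hlin : ∫⁻ ω, ENNReal.ofReal (Real.exp (a * Z ω ^ 2)) ∂P ≤ ENNReal.ofReal 2 := by
    have hsum : ∀ ω, ENNReal.ofReal (Real.exp (a * Z ω ^ 2))
        = ∑' p : ℕ, ENNReal.ofReal ((a * Z ω ^ 2) ^ p / p.factorial) := fun ω => by
      rw [← ENNReal.ofReal_tsum_of_nonneg (fun p => by positivity)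
        (Real.summable_pow_div_factorial _), Real.exp_eq_exp_ℝ, NormedSpace.exp_eq_tsum_div]
    simp_rw [hsum]
    rw [lintegral_tsum fun p => by fun_prop]
    refine (ENNReal.tsum_le_tsum hterm).trans_eq ?_
    rw [← ENNReal.ofReal_tsum_of_nonneg (fun p => by positivity)
      (summable_geometric_of_lt_one (by norm_num) (by norm_num)), tsum_geometric_two]
  have hmeas : AEStronglyMeasurable (fun ω => Real.exp (a * Z ω ^ 2)) P :=
    AEMeasurable.aestronglyMeasurable (by fun_prop)
  refine ⟨hm, ⟨hmeas, ?_⟩, ?_⟩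
  · rw [hasFiniteIntegral_iff_ofReal (ae_of_all _ fun _ => (Real.exp_pos _).le)]
    exact hlin.trans_lt ENNReal.ofReal_lt_top
  · rw [integral_eq_lintegral_of_nonneg_ae (ae_of_all _ fun _ => (Real.exp_pos _).le) hmeas]
    exact ENNReal.toReal_le_of_le_ofReal (by norm_num) hlin

lemma exp_sub_le (x : ℝ) : Real.exp x ≤ 1 + x + x ^ 2 * Real.exp |x| := by
  have h := Complex.norm_exp_sub_sum_le_norm_mul_exp (x : ℂ) 2
  simp only [Finset.sum_range_succ, Finset.sum_range_zero, pow_zero, Nat.factorial, pow_one] at h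
  have h1 : Complex.exp x - (0 + 1 / ((1 : ℕ) : ℂ) + x / (((0 + 1) * 1 : ℕ) : ℂ))
      = ((Real.exp x - (1 + x) : ℝ) : ℂ) := by
    push_cast; simp
  rw [h1, Complex.norm_real, Complex.norm_real, Real.norm_eq_abs, Real.norm_eq_abs, sq_abs] at h
  have := (le_abs_self _).trans h
  linarith

/-- Centering kills the linear Taylor term. Of the exponent `a * |W|`, one half dominates `W ^ 2`
(with constant `8 / a ^ 2`) and the other half dominates `exp |t * W|`. -/
lemma mgf_le_of_expMoment [IsProbabilityMeasure P] {W : Ω → ℝ} {a C t : ℝ} (ha : 0 < a)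
    (hm : AEMeasurable W P) (hi : Integrable (fun ω => Real.exp (a * |W ω|)) P)
    (hC : ∫ ω, Real.exp (a * |W ω|) ∂P ≤ C) (h0 : ∫ ω, W ω ∂P = 0) (ht : |t| ≤ a / 2) :
    Integrable (fun ω => Real.exp (t * W ω)) P ∧
      mgf W P t ≤ Real.exp (8 * C * t ^ 2 / a ^ 2) := by
  have hint : Integrable (fun ω => Real.exp (t * W ω)) P := by
    refine hi.mono' (AEMeasurable.aestronglyMeasurable (by fun_prop)) (ae_of_all _ fun ω => ?_)
    rw [Real.norm_eq_abs, abs_of_pos (Real.exp_pos _), Real.exp_le_exp]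
    refine (le_abs_self _).trans ?_
    rw [abs_mul]
    exact mul_le_mul_of_nonneg_right (by linarith) (abs_nonneg _)
  refine ⟨hint, ?_⟩
  have hW : Integrable W P := by
    refine (hi.const_mul a⁻¹).mono' hm.aestronglyMeasurable (ae_of_all _ fun ω => ?_)
    rw [Real.norm_eq_abs, ← div_eq_inv_mul, le_div_iff₀ ha]
    have := Real.add_one_le_exp (a * |W ω|)
    linarith
  have hpt : ∀ ω, Real.exp (t * W ω) ≤ 1 + t * W ω + 8 * t ^ 2 / a ^ 2 * Real.exp (a * |W ω|) := by
    intro ω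
    refine (exp_sub_le _).trans ?_
    have h1 := Real.pow_div_factorial_le_exp (x := a / 2 * |W ω|) (by positivity) 2
    have h2 : Real.exp |t * W ω| ≤ Real.exp (a / 2 * |W ω|) := by
      rw [Real.exp_le_exp, abs_mul]
      exact mul_le_mul_of_nonneg_right ht (abs_nonneg _)
    have h3 : (t * W ω) ^ 2 ≤ 8 * t ^ 2 / a ^ 2 * Real.exp (a / 2 * |W ω|) := by
      have h4 : (a / 2 * |W ω|) ^ 2 / (Nat.factorial 2 : ℝ) = a ^ 2 / 8 * W ω ^ 2 := by
        rw [mul_pow, sq_abs]; norm_num [Nat.factorial]; ring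
      rw [h4] at h1
      calc (t * W ω) ^ 2 = 8 * t ^ 2 / a ^ 2 * (a ^ 2 / 8 * W ω ^ 2) := by field_simp
        _ ≤ _ := by gcongr
    have h5 : Real.exp (a * |W ω|) = Real.exp (a / 2 * |W ω|) * Real.exp (a / 2 * |W ω|) := by
      rw [← Real.exp_add]; congr 1; ring
    rw [h5, ← mul_assoc]
    gcongr
  have hi2 : Integrable (fun ω => 8 * t ^ 2 / a ^ 2 * Real.exp (a * |W ω|)) P := hi.const_mul _
  have hi1 : Integrable (fun ω => 1 + t * W ω) P := (integrable_const 1).add (hW.const_mul t)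
  calc mgf W P t ≤ ∫ ω, (1 + t * W ω + 8 * t ^ 2 / a ^ 2 * Real.exp (a * |W ω|)) ∂P :=
        integral_mono hint (hi1.add hi2) hpt
    _ = 1 + 8 * t ^ 2 / a ^ 2 * ∫ ω, Real.exp (a * |W ω|) ∂P := by
        rw [integral_add hi1 hi2, integral_add (integrable_const 1) (hW.const_mul t),
          integral_const_mul, integral_const_mul, h0]
        simp
    _ ≤ 1 + 8 * t ^ 2 / a ^ 2 * C := by gcongr
    _ ≤ Real.exp (8 * t ^ 2 / a ^ 2 * C) := by
        have := Real.add_one_le_exp (8 * t ^ 2 / a ^ 2 * C); linarith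
    _ = _ := by congr 1; ring

lemma measureReal_mean_ge_le [IsProbabilityMeasure P] {n : ℕ} {W : Fin n → Ω → ℝ} {a C u : ℝ}
    (ha : 0 < a) (hC0 : 0 < C) (hm : ∀ i, AEMeasurable (W i) P) (hind : iIndepFun W P)
    (hi : ∀ i, Integrable (fun ω => Real.exp (a * |W i ω|)) P)
    (hC : ∀ i, ∫ ω, Real.exp (a * |W i ω|) ∂P ≤ C) (h0 : ∀ i, ∫ ω, W i ω ∂P = 0)
    (hu0 : 0 ≤ u) (hu : u ≤ 8 * C / a) :
    P.real {ω | n * u ≤ ∑ i, W i ω} ≤ Real.exp (-(a ^ 2 / (32 * C) * n * u ^ 2)) := by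
  -- The minimizer of `8 * C * t ^ 2 / a ^ 2 - t * u`; the bound on `u` is what keeps it within `a /
  -- 2`.
  set t := u * a ^ 2 / (16 * C) with ht
  have ht0 : 0 ≤ t := by positivity
  have hta : |t| ≤ a / 2 := by
    rw [abs_of_nonneg ht0, ht, div_le_iff₀ (by positivity)]
    rw [le_div_iff₀ ha] at hu
    nlinarith
  have hmgf := fun i => mgf_le_of_expMoment ha (hm i) (hi i) (hC i) (h0 i) hta
  have hsum : (∑ i, W i) = fun ω => ∑ i, W i ω := by ext; simp
  have hint : Integrable (fun ω => Real.exp (t * ∑ i, W i ω)) P := by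
    -- A nonintegrable function has Bochner integral zero, whereas this integral is a product of
    -- positive moment generating functions.
    refine Integrable.of_integral_ne_zero ?_
    have h2 := hind.mgf_sum₀ (t := t) hm Finset.univ
    rw [hsum, mgf] at h2
    rw [h2]
    exact (Finset.prod_pos fun i _ => mgf_pos (hmgf i).1).ne'
  have h1 := measure_ge_le_exp_mul_mgf (μ := P) (X := fun ω => ∑ i, W i ω) (n * u) ht0 hint
  refine h1.trans ?_
  rw [← hsum, hind.mgf_sum₀ hm]
  calc Real.exp (-t * (n * u)) * ∏ i, mgf (W i) P t
      ≤ Real.exp (-t * (n * u)) * ∏ _i : Fin n, Real.exp (8 * C * t ^ 2 / a ^ 2) := by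
        refine mul_le_mul_of_nonneg_left ?_ (Real.exp_pos _).le
        exact Finset.prod_le_prod (fun _ _ => mgf_nonneg) fun i _ => (hmgf i).2
    _ = Real.exp (-(a ^ 2 / (32 * C) * n * u ^ 2)) := by
        rw [Finset.prod_const, Finset.card_univ, Fintype.card_fin, ← Real.exp_nat_mul,
          ← Real.exp_add, ht]
        congr 1
        field_simp
        ring

lemma measureReal_abs_mean_ge_le [IsProbabilityMeasure P] {n : ℕ} {W : Fin n → Ω → ℝ} {a C u : ℝ}
    (ha : 0 < a) (hC0 : 0 < C) (hm : ∀ i, AEMeasurable (W i) P) (hind : iIndepFun W P)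
    (hi : ∀ i, Integrable (fun ω => Real.exp (a * |W i ω|)) P)
    (hC : ∀ i, ∫ ω, Real.exp (a * |W i ω|) ∂P ≤ C) (h0 : ∀ i, ∫ ω, W i ω ∂P = 0)
    (hu0 : 0 ≤ u) (hu : u ≤ 8 * C / a) :
    P.real {ω | n * u ≤ |∑ i, W i ω|} ≤ 2 * Real.exp (-(a ^ 2 / (32 * C) * n * u ^ 2)) := by
  have h1 := measureReal_mean_ge_le ha hC0 hm hind hi hC h0 hu0 hu
  have h2 := measureReal_mean_ge_le (W := fun i ω => -W i ω) ha hC0 (fun i => (hm i).neg)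
    (hind.comp (fun _ x => -x) fun _ => measurable_neg) (by simpa using hi) (by simpa using hC)
    (fun i => by rw [integral_neg, h0 i, neg_zero]) hu0 hu
  have hsub : {ω | (n : ℝ) * u ≤ |∑ i, W i ω|} ⊆
      {ω | n * u ≤ ∑ i, W i ω} ∪ {ω | n * u ≤ ∑ i, -W i ω} := by
    intro ω hω
    rcases le_abs.1 (show (n : ℝ) * u ≤ |∑ i, W i ω| from hω) with h | h
    · exact Or.inl h
    · exact Or.inr (by simpa using h)
  have := (measureReal_mono (μ := P) hsub).trans (measureReal_union_le _ _)
  linarith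

end Tails

/-! ### Products of sub-Gaussian variables. -/

section Products

variable {Ω : Type*} [MeasurableSpace Ω] {P : Measure Ω}

/-- The arithmetic–geometric mean inequality, once in the exponent and once outside. It gives
products exponential moments without independence of the factors. -/
lemma exp_mul_abs_mul_le {a : ℝ} (ha : 0 ≤ a) (x y : ℝ) :
    Real.exp (a * |x * y|) ≤ (Real.exp (a * x ^ 2) + Real.exp (a * y ^ 2)) / 2 := by
  have h1 : a * |x * y| ≤ a * x ^ 2 / 2 + a * y ^ 2 / 2 := by
    have : |x * y| ≤ (x ^ 2 + y ^ 2) / 2 := by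
      rw [abs_mul, ← sq_abs x, ← sq_abs y]
      nlinarith [sq_nonneg (|x| - |y|)]
    calc a * |x * y| ≤ a * ((x ^ 2 + y ^ 2) / 2) := by gcongr
      _ = _ := by ring
  have h2 : Real.exp (a * |x * y|) ≤ Real.exp (a * x ^ 2 / 2) * Real.exp (a * y ^ 2 / 2) := by
    rw [← Real.exp_add]; exact Real.exp_le_exp.2 h1
  have h3 : ∀ z : ℝ, Real.exp (a * z ^ 2) = Real.exp (a * z ^ 2 / 2) ^ 2 := fun z => by
    rw [← Real.exp_nat_mul]; congr 1; push_cast; ring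
  rw [h3 x, h3 y]
  nlinarith [sq_nonneg (Real.exp (a * x ^ 2 / 2) - Real.exp (a * y ^ 2 / 2))]

variable {U V : Ω → ℝ} {a : ℝ}

lemma ExpSqBound.integrable_exp_mul (ha : 0 ≤ a) (hU : ExpSqBound a U P) (hV : ExpSqBound a V P) :
    Integrable (fun ω => Real.exp (a * |U ω * V ω|)) P := by
  have hmU := hU.aemeasurable
  have hmV := hV.aemeasurable
  refine ((hU.integrable.add hV.integrable).div_const 2).mono'
    (AEMeasurable.aestronglyMeasurable (by fun_prop)) (ae_of_all _ fun ω => ?_)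
  rw [Real.norm_eq_abs, abs_of_pos (Real.exp_pos _)]
  exact exp_mul_abs_mul_le ha _ _

lemma ExpSqBound.integral_exp_mul_le (ha : 0 ≤ a) (hU : ExpSqBound a U P)
    (hV : ExpSqBound a V P) : ∫ ω, Real.exp (a * |U ω * V ω|) ∂P ≤ 2 := by
  calc ∫ ω, Real.exp (a * |U ω * V ω|) ∂P
      ≤ ∫ ω, (Real.exp (a * U ω ^ 2) + Real.exp (a * V ω ^ 2)) / 2 ∂P :=
        integral_mono (hU.integrable_exp_mul ha hV)
          ((hU.integrable.add hV.integrable).div_const 2) fun ω => exp_mul_abs_mul_le ha _ _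
    _ = (∫ ω, Real.exp (a * U ω ^ 2) ∂P + ∫ ω, Real.exp (a * V ω ^ 2) ∂P) / 2 := by
        rw [integral_div, integral_add hU.integrable hV.integrable]
    _ ≤ 2 := by linarith [hU.integral_le, hV.integral_le]

lemma ExpSqBound.integrable_mul (ha : 0 < a) (hU : ExpSqBound a U P) (hV : ExpSqBound a V P) :
    Integrable (fun ω => U ω * V ω) P := by
  refine ((hU.integrable_exp_mul ha.le hV).const_mul a⁻¹).mono'
    (hU.aemeasurable.mul hV.aemeasurable).aestronglyMeasurable (ae_of_all _ fun ω => ?_)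
  rw [Real.norm_eq_abs, ← div_eq_inv_mul, le_div_iff₀ ha]
  have := Real.add_one_le_exp (a * |U ω * V ω|)
  linarith

lemma ExpSqBound.abs_integral_mul_le (ha : 0 < a) (hU : ExpSqBound a U P)
    (hV : ExpSqBound a V P) : a * |∫ ω, U ω * V ω ∂P| ≤ 2 := by
  calc a * |∫ ω, U ω * V ω ∂P| ≤ a * ∫ ω, |U ω * V ω| ∂P := by
        gcongr; exact abs_integral_le_integral_abs
    _ = ∫ ω, a * |U ω * V ω| ∂P := by rw [integral_const_mul]
    _ ≤ ∫ ω, Real.exp (a * |U ω * V ω|) ∂P := by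
        refine integral_mono ((hU.integrable_mul ha hV).abs.const_mul a)
          (hU.integrable_exp_mul ha.le hV) fun ω => ?_
        have := Real.add_one_le_exp (a * |U ω * V ω|)
        simp only
        linarith
    _ ≤ 2 := hU.integral_exp_mul_le ha.le hV

/-- Centering costs only a factor `exp 2`, since the mean satisfies `a * |m| ≤ 2`. -/
lemma ExpSqBound.integrable_exp_mul_sub [IsProbabilityMeasure P] (ha : 0 < a)
    (hU : ExpSqBound a U P) (hV : ExpSqBound a V P) {m : ℝ} (hm : ∫ ω, U ω * V ω ∂P = m) :
    Integrable (fun ω => Real.exp (a * |U ω * V ω - m|)) P ∧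
      ∫ ω, Real.exp (a * |U ω * V ω - m|) ∂P ≤ 2 * Real.exp 2 := by
  have hmU := hU.aemeasurable
  have hmV := hV.aemeasurable
  have hm2 : a * |m| ≤ 2 := hm ▸ hU.abs_integral_mul_le ha hV
  have hpt : ∀ ω, Real.exp (a * |U ω * V ω - m|) ≤ Real.exp 2 * Real.exp (a * |U ω * V ω|) := by
    intro ω
    rw [← Real.exp_add, Real.exp_le_exp]
    have := mul_le_mul_of_nonneg_left (abs_sub (U ω * V ω) m) ha.le
    linarith
  have hi := (hU.integrable_exp_mul ha.le hV).const_mul (Real.exp 2)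
  have hi2 : Integrable (fun ω => Real.exp (a * |U ω * V ω - m|)) P := by
    refine hi.mono' (AEMeasurable.aestronglyMeasurable (by fun_prop)) (ae_of_all _ fun ω => ?_)
    rw [Real.norm_eq_abs, abs_of_pos (Real.exp_pos _)]
    exact hpt ω
  refine ⟨hi2, (integral_mono hi2 hi hpt).trans ?_⟩
  rw [integral_const_mul, mul_comm]
  exact mul_le_mul_of_nonneg_right (hU.integral_exp_mul_le ha.le hV) (Real.exp_pos _).le

lemma ExpSqBound.integrable_pow_four (ha : 0 < a) (hU : ExpSqBound a U P) :
    Integrable (fun ω => U ω ^ 4) P ∧ ∫ ω, U ω ^ 4 ∂P ≤ 4 / a ^ 2 := by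
  have hpt : ∀ ω, U ω ^ 4 ≤ 2 / a ^ 2 * Real.exp (a * U ω ^ 2) := by
    intro ω
    have h := Real.pow_div_factorial_le_exp (x := a * U ω ^ 2) (by positivity) 2
    calc U ω ^ 4 = 2 / a ^ 2 * ((a * U ω ^ 2) ^ 2 / (Nat.factorial 2 : ℝ)) := by
          norm_num [Nat.factorial]; field_simp
      _ ≤ _ := by gcongr
  have hi := hU.integrable.const_mul (2 / a ^ 2)
  have hi2 : Integrable (fun ω => U ω ^ 4) P := by
    refine hi.mono' (hU.aemeasurable.pow_const 4).aestronglyMeasurable (ae_of_all _ fun ω => ?_)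
    rw [Real.norm_eq_abs, abs_of_nonneg (by positivity)]
    exact hpt ω
  refine ⟨hi2, (integral_mono hi2 hi hpt).trans ?_⟩
  rw [integral_const_mul]
  calc 2 / a ^ 2 * ∫ ω, Real.exp (a * U ω ^ 2) ∂P ≤ 2 / a ^ 2 * 2 := by
        gcongr; exact hU.integral_le
    _ = _ := by ring

/-- Concentration of an average of independent products of sub-Gaussian variables. -/
lemma measureReal_abs_mean_mul_sub_ge_le [IsProbabilityMeasure P] {n : ℕ} (hn : 1 ≤ n)
    {U V : Fin n → Ω → ℝ} {u m : ℝ} (ha : 0 < a)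
    (hU : ∀ i, ExpSqBound a (U i) P) (hV : ∀ i, ExpSqBound a (V i) P)
    (hind : iIndepFun (fun i ω => U i ω * V i ω) P) (hm : ∀ i, ∫ ω, U i ω * V i ω ∂P = m)
    (hu0 : 0 ≤ u) (hu : u ≤ 16 / a) :
    P.real {ω | u ≤ |(n : ℝ)⁻¹ * ∑ i, U i ω * V i ω - m|} ≤
      2 * Real.exp (-(a ^ 2 / (64 * Real.exp 2) * n * u ^ 2)) := by
  have hn0 : (0 : ℝ) < n := by exact_mod_cast hn
  have hE := fun i => (hU i).integrable_exp_mul_sub ha (hV i) (hm i)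
  have h := measureReal_abs_mean_ge_le (W := fun i ω => U i ω * V i ω - m) (u := u) ha
    (by positivity : 0 < 2 * Real.exp 2)
    (fun i => ((hU i).aemeasurable.mul (hV i).aemeasurable).sub_const m)
    (hind.comp (fun _ x => x - m) fun _ => by fun_prop) (fun i => (hE i).1) (fun i => (hE i).2)
    (fun i => by
      rw [integral_sub ((hU i).integrable_mul ha (hV i)) (integrable_const m), hm i]; simp)
    hu0 (hu.trans (by
      have := Real.one_le_exp (zero_le_two (α := ℝ))
      gcongr
      linarith))
  convert h using 2
  · ext ω
    simp only [Set.mem_ofPred_eq, Finset.sum_sub_distrib, Finset.sum_const, Finset.card_univ,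
      Fintype.card_fin, nsmul_eq_mul]
    have h1 : (n : ℝ)⁻¹ * ∑ i, U i ω * V i ω - m
        = (n : ℝ)⁻¹ * (∑ i, U i ω * V i ω - n * m) := by field_simp
    rw [h1, abs_mul, abs_of_pos (inv_pos.2 hn0), ← div_eq_inv_mul, le_div_iff₀ hn0, mul_comm]
  · congr 2; ring

end Products

/-! ### Second-order expansion of characteristic functions. -/

section CentralLimit

/-- Taylor's remainder with `e ≤ 4` for `|x| ≤ 1`; beyond that the cubic dominates each term
separately. -/
lemma norm_exp_mul_I_sub_le (x : ℝ) :
    ‖Complex.exp (x * Complex.I) - (1 + x * Complex.I - x ^ 2 / 2)‖ ≤ 4 * |x| ^ 3 := by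
  rcases le_or_gt |x| 1 with hx | hx
  · have h := Complex.norm_exp_sub_sum_le_norm_mul_exp (x * Complex.I) 3
    have hn : ‖(x : ℂ) * Complex.I‖ = |x| := by simp
    have hs : ∑ m ∈ Finset.range 3, ((x : ℂ) * Complex.I) ^ m / (m.factorial : ℂ)
        = 1 + x * Complex.I - x ^ 2 / 2 := by
      simp [Finset.sum_range_succ, Nat.factorial, mul_pow]
      ring
    rw [hn, hs] at h
    refine h.trans ?_
    have : Real.exp |x| ≤ 4 := (Real.exp_le_exp.2 hx).trans (by
      have := Real.exp_one_lt_d9; linarith)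
    rw [mul_comm]
    gcongr
  · have h1 : ‖Complex.exp (x * Complex.I)‖ = 1 := Complex.norm_exp_ofReal_mul_I x
    have h2 : ‖(1 : ℂ) + x * Complex.I - x ^ 2 / 2‖ ≤ 1 + |x| + |x| ^ 2 / 2 := by
      refine (norm_sub_le _ _).trans (add_le_add ((norm_add_le _ _).trans ?_) ?_)
      · simp
      · simp
    refine (norm_sub_le _ _).trans ?_
    rw [h1]
    nlinarith [pow_pos (zero_lt_one.trans hx) 2, mul_pos (sub_pos.2 hx) (sub_pos.2 hx),
      mul_pos (pow_pos (zero_lt_one.trans hx) 2) (sub_pos.2 hx)]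

variable {Ω : Type*} [MeasurableSpace Ω] {P : Measure Ω}

/-- The cubic remainder is integrated by means of `|W| ^ 3 ≤ 1 + W ^ 4`, so a fourth-moment bound is
enough for uniformity over the array. -/
lemma norm_charFun_sub_le [IsProbabilityMeasure P] {W : Ω → ℝ} {C : ℝ} (hm : AEMeasurable W P)
    (hi4 : Integrable (fun ω => W ω ^ 4) P) (h4 : ∫ ω, W ω ^ 4 ∂P ≤ C)
    (h1 : ∫ ω, W ω ∂P = 0) (h2 : ∫ ω, W ω ^ 2 ∂P = 1) (t : ℝ) :
    ‖charFun (P.map W) t - (1 - t ^ 2 / 2)‖ ≤ 4 * |t| ^ 3 * (1 + C) := by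
  have habs : ∀ (k : ℕ), k ≤ 4 → ∀ x : ℝ, |x| ^ k ≤ 1 + x ^ 4 := by
    intro k hk x
    have hx4 : x ^ 4 = |x| ^ 4 := by rw [show 4 = 2 * 2 by norm_num, pow_mul, pow_mul, sq_abs]
    rw [hx4]
    rcases le_total |x| 1 with h | h
    · have := pow_le_one₀ (n := k) (abs_nonneg x) h
      have : 0 ≤ |x| ^ 4 := by positivity
      linarith
    · have := pow_le_pow_right₀ h hk
      linarith
  have hi14 : Integrable (fun ω => 1 + W ω ^ 4) P := (integrable_const 1).add hi4
  have hik : ∀ k ≤ 4, Integrable (fun ω => W ω ^ k) P := fun k hk => by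
    refine hi14.mono' (hm.pow_const k).aestronglyMeasurable (ae_of_all _ fun ω => ?_)
    rw [norm_pow, Real.norm_eq_abs]
    exact habs k hk _
  have hi1 : Integrable W P := by simpa using hik 1 (by norm_num)
  have hexp : Integrable (fun ω => Complex.exp ((t * W ω : ℝ) * Complex.I)) P := by
    refine (integrable_const (1 : ℝ)).mono' (AEMeasurable.aestronglyMeasurable (by fun_prop))
      (ae_of_all _ fun ω => ?_)
    rw [Complex.norm_exp_ofReal_mul_I]
  have hc : charFun (P.map W) t = ∫ ω, Complex.exp ((t * W ω : ℝ) * Complex.I) ∂P := by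
    rw [charFun_apply_real, integral_map hm (by fun_prop)]
    push_cast
    rfl
  have hipoly : Integrable (fun ω => (1 : ℂ) + (t * W ω : ℝ) * Complex.I
      - ((t * W ω : ℝ) : ℂ) ^ 2 / 2) P := by
    have e1 : Integrable (fun ω => ((t * W ω : ℝ) : ℂ) * Complex.I) P :=
      (hi1.const_mul t).ofReal.mul_const _
    have e2 : Integrable (fun ω => (((t ^ 2 / 2 * W ω ^ 2 : ℝ)) : ℂ)) P :=
      ((hik 2 (by norm_num)).const_mul (t ^ 2 / 2)).ofReal
    refine (((integrable_const 1).add e1).sub e2).congr (ae_of_all _ fun ω => ?_)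
    simp only [Pi.add_apply, Pi.sub_apply]
    push_cast
    ring
  have hpoly : ∫ ω, ((1 : ℂ) + (t * W ω : ℝ) * Complex.I - ((t * W ω : ℝ) : ℂ) ^ 2 / 2) ∂P
      = (1 : ℂ) - (t : ℂ) ^ 2 / 2 := by
    have e1 : Integrable (fun ω => ((t * W ω : ℝ) : ℂ) * Complex.I) P :=
      (hi1.const_mul t).ofReal.mul_const _
    have e2 : Integrable (fun ω => (((t ^ 2 / 2 * W ω ^ 2 : ℝ)) : ℂ)) P :=
      ((hik 2 (by norm_num)).const_mul (t ^ 2 / 2)).ofReal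
    have e3 : ∀ ω, (1 : ℂ) + (t * W ω : ℝ) * Complex.I - ((t * W ω : ℝ) : ℂ) ^ 2 / 2
        = 1 + (t * W ω : ℝ) * Complex.I - ((t ^ 2 / 2 * W ω ^ 2 : ℝ) : ℂ) := fun ω => by
      push_cast; ring
    simp_rw [e3]
    have e0 : Integrable (fun ω => (1 : ℂ) + ((t * W ω : ℝ) : ℂ) * Complex.I) P :=
      (integrable_const 1).add e1
    rw [integral_sub e0 e2, integral_add (integrable_const 1) e1,
      integral_mul_const, integral_complex_ofReal, integral_complex_ofReal, integral_const_mul, integral_const_mul,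
      h1, h2]
    simp
  rw [hc, ← hpoly, ← integral_sub hexp hipoly]
  calc _ ≤ ∫ ω, 4 * |t| ^ 3 * (1 + W ω ^ 4) ∂P := by
        refine norm_integral_le_of_norm_le (hi14.const_mul _) (ae_of_all _ fun ω => ?_)
        refine (norm_exp_mul_I_sub_le _).trans ?_
        rw [abs_mul, mul_pow, ← mul_assoc]
        gcongr
        exact habs 3 (by norm_num) _
    _ = 4 * |t| ^ 3 * (1 + ∫ ω, W ω ^ 4 ∂P) := by
        rw [integral_const_mul, integral_add (integrable_const 1) hi4]; simp
    _ ≤ _ := by gcongr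

end CentralLimit

/-! ### Central limit theorem for arrays. -/

section TriangularArray

variable {Ω : ℕ → Type*} [∀ n, MeasurableSpace (Ω n)] {P : ∀ n, Measure (Ω n)}
  [∀ n, IsProbabilityMeasure (P n)]

/-- The central limit theorem for arrays with i.i.d. rows and bounded fourth moments. -/
theorem tendsto_measureReal_sum_le_cdf {W : ∀ n, Fin n → Ω n → ℝ} {C : ℝ}
    (hm : ∀ n i, AEMeasurable (W n i) (P n)) (hind : ∀ n, 1 ≤ n → iIndepFun (W n) (P n))
    (hid : ∀ n i j, IdentDistrib (W n i) (W n j) (P n) (P n))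
    (hi4 : ∀ n i, Integrable (fun ω => W n i ω ^ 4) (P n))
    (h4 : ∀ n i, ∫ ω, W n i ω ^ 4 ∂(P n) ≤ C) (h1 : ∀ n i, ∫ ω, W n i ω ∂(P n) = 0)
    (h2 : ∀ n i, ∫ ω, W n i ω ^ 2 ∂(P n) = 1) (x : ℝ) :
    Tendsto (fun n : ℕ => (P n).real {ω | (√(n : ℝ))⁻¹ * ∑ i, W n i ω ≤ x}) atTop
      (𝓝 (cdf (gaussianReal 0 1) x)) := by
  set Z : ∀ n, Ω n → ℝ := fun n ω => (√(n : ℝ))⁻¹ * ∑ i, W n i ω with hZ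
  have hsm : ∀ n, AEMeasurable (fun ω => ∑ i, W n i ω) (P n) := fun n =>
    Finset.aemeasurable_fun_sum _ fun i _ => hm n i
  have hZm : ∀ n, AEMeasurable (Z n) (P n) := fun n => (hsm n).const_mul _
  let μs : ℕ → ProbabilityMeasure ℝ := fun n =>
    ⟨(P n).map (Z n), Measure.isProbabilityMeasure_map (hZm n)⟩
  let μ : ProbabilityMeasure ℝ := ⟨gaussianReal 0 1, inferInstance⟩
  have hlim : Tendsto μs atTop (𝓝 μ) := by
    rw [ProbabilityMeasure.tendsto_iff_tendsto_charFun]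
    intro t
    have hgoal : charFun (μ : Measure ℝ) t = Complex.exp (-t ^ 2 / 2) := by
      change charFun (gaussianReal 0 1) t = _
      rw [charFun_gaussianReal]
      congr 1
      simp
      ring
    rw [hgoal]
    -- The characteristic function of one normalized summand; its `n`-th power is that of the sum.
    -- The value at `n = 0`, where there is no summand, is irrelevant in the limit.
    let f : ℕ → ℂ := fun n => if h : 0 < n then
      charFun ((P n).map (W n ⟨0, h⟩)) ((√(n : ℝ))⁻¹ * t) else 0
    have hf : ∀ᶠ n in atTop, f n ^ n = charFun (μs n : Measure ℝ) t := by
      filter_upwards [eventually_gt_atTop 0] with n hn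
      change f n ^ n = charFun ((P n).map (Z n)) t
      rw [hZ, charFun_map_mul_comp (hsm n), (hind n hn).charFun_map_fun_sum_eq_prod (hm n)]
      simp only [f, hn, dif_pos, Finset.prod_apply]
      rw [Finset.prod_congr rfl fun i _ => by rw [(hid n i ⟨0, hn⟩).map_eq]]
      simp
    refine Tendsto.congr' hf ?_
    refine Complex.tendsto_pow_exp_of_isLittleO_sub_add_div _ ?_
    -- The error is of order `n ^ (-3/2)`, hence `o(1 / n)`, as the limit of `(1 + z / n + o(1 / n))
    -- ^ n` requires.
    have hbd : ∀ᶠ n : ℕ in atTop, ‖f n - (1 + (-t ^ 2 / 2 : ℂ) / n)‖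
        ≤ 4 * |t| ^ 3 * (1 + C) * (√(n : ℝ))⁻¹ * ‖1 / (n : ℂ)‖ := by
      filter_upwards [eventually_gt_atTop 0] with n hn
      have hn0 : (0 : ℝ) < n := by exact_mod_cast hn
      have h := norm_charFun_sub_le (hm n ⟨0, hn⟩) (hi4 n _) (h4 n _) (h1 n _) (h2 n _)
        ((√(n : ℝ))⁻¹ * t)
      have hs2 : (√(n : ℝ))⁻¹ ^ 2 = (n : ℝ)⁻¹ := by rw [inv_pow, Real.sq_sqrt hn0.le]
      have e1 : (1 : ℂ) - ((((√(n : ℝ))⁻¹ * t : ℝ)) : ℂ) ^ 2 / 2 = 1 + (-t ^ 2 / 2 : ℂ) / n := by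
        rw [← Complex.ofReal_pow, mul_pow, hs2]
        push_cast
        ring
      rw [e1] at h
      simp only [f, hn, dif_pos]
      refine h.trans_eq ?_
      rw [abs_mul, abs_of_nonneg (by positivity), mul_pow, pow_succ, hs2]
      simp
      ring
    refine Asymptotics.isLittleO_iff.2 fun c hc => ?_
    have hlim0 : Tendsto (fun n : ℕ => 4 * |t| ^ 3 * (1 + C) * (√(n : ℝ))⁻¹) atTop (𝓝 0) := by
      have := (tendsto_inv_atTop_zero.comp
        (Real.tendsto_sqrt_atTop.comp tendsto_natCast_atTop_atTop)).const_mul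
          (4 * |t| ^ 3 * (1 + C))
      simpa using this
    filter_upwards [hbd, hlim0.eventually_le_const hc] with n hn hn2
    exact hn.trans (mul_le_mul_of_nonneg_right hn2 (norm_nonneg _))
  have hfr : (μ : ProbabilityMeasure ℝ) (frontier (Set.Iic x)) = 0 := by
    have : (gaussianReal 0 1) (frontier (Set.Iic x)) = 0 := by
      rw [frontier_Iic]
      have := nullSingletonClass_gaussianReal (μ := 0) (v := 1) one_ne_zero
      exact measure_singleton x
    rw [← ENNReal.coe_inj]
    simpa [μ] using this
  have h := ProbabilityMeasure.tendsto_measure_of_null_frontier_of_tendsto hlim hfr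
  have h' := (NNReal.continuous_coe.tendsto _).comp h
  rw [cdf_eq_real]
  refine (h'.congr fun n => ?_)
  change ((P n).map (Z n)).real (Set.Iic x) = _
  rw [map_measureReal_apply_of_aemeasurable (hZm n) measurableSet_Iic]
  rfl

end TriangularArray

/-! ### Moments in the linear model and properties of `v*`. -/

section Model

variable {n d : ℕ} {Ω : Type*} [MeasurableSpace Ω] {P : Measure Ω}
  {X : Ω → Matrix (Fin n) (Fin d) ℝ} {Y : Ω → Fin n → ℝ} {βstar : Fin d → ℝ}
  {K KX Cε δ : ℝ}

/-- The variance of the centered errors, written without reference to an index. -/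
noncomputable def errorVariance (P : Measure Ω) (X : Ω → Matrix (Fin n) (Fin d) ℝ)
    (Y : Ω → Fin n → ℝ) (βstar : Fin d → ℝ) : ℝ :=
  (n : ℝ)⁻¹ * ∑ i, ∫ ω, modelResidual (X ω) (Y ω) βstar i ^ 2 ∂P

namespace LinearModel

/-- The error is a measurable function of the observation, so functions of design and error inherit
independence and identical distribution from the sample. -/
lemma measurable_comp_residual {φ : (Fin d → ℝ) × ℝ → ℝ} (hφ : Measurable φ) (b : Fin d → ℝ) :
    Measurable fun p : (Fin d → ℝ) × ℝ => φ (p.1, p.2 - p.1 ⬝ᵥ b) :=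
  hφ.comp (by unfold dotProduct; fun_prop)

lemma iIndepFun_comp (h : LinearModel P X Y βstar K KX Cε δ) {φ : (Fin d → ℝ) × ℝ → ℝ}
    (hφ : Measurable φ) :
    iIndepFun (fun (i : Fin n) ω => φ (X ω i, modelResidual (X ω) (Y ω) βstar i)) P :=
  h.indep.comp _ fun _ => measurable_comp_residual hφ βstar

lemma identDistrib_comp (h : LinearModel P X Y βstar K KX Cε δ) {φ : (Fin d → ℝ) × ℝ → ℝ}
    (hφ : Measurable φ) (i j : Fin n) :
    IdentDistrib (fun ω => φ (X ω i, modelResidual (X ω) (Y ω) βstar i))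
      (fun ω => φ (X ω j, modelResidual (X ω) (Y ω) βstar j)) P P :=
  (h.identDistrib i j).comp (measurable_comp_residual hφ βstar)

lemma aemeasurable_design (h : LinearModel P X Y βstar K KX Cε δ) (i : Fin n) (j : Fin d) :
    AEMeasurable (fun ω => X ω i j) P :=
  (h.identDistrib_comp (φ := fun p => p.1 j) (by fun_prop) i i).aemeasurable_fst

lemma aemeasurable_error (h : LinearModel P X Y βstar K KX Cε δ) (i : Fin n) :
    AEMeasurable (fun ω => modelResidual (X ω) (Y ω) βstar i) P :=
  (h.identDistrib_comp (φ := fun p => p.2) (by fun_prop) i i).aemeasurable_fst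

lemma secondMoment_apply (h : LinearModel P X Y βstar K KX Cε δ) {a : ℝ} (ha : 0 < a)
    (hX : ∀ i j, ExpSqBound a (fun ω => X ω i j) P) (i : Fin n) (j k : Fin d) :
    ∫ ω, X ω i j * X ω i k ∂P = secondMoment P X j k := by
  have hn : (n : ℝ) ≠ 0 := by exact_mod_cast (Fin.pos i).ne'
  simp only [secondMoment, Matrix.of_apply, Matrix.mul_apply, Matrix.transpose_apply]
  rw [integral_finsetSum _ fun l _ => (hX l j).integrable_mul ha (hX l k),
    Finset.sum_congr rfl fun l _ =>
      (h.identDistrib_comp (φ := fun p => p.1 j * p.1 k) (by fun_prop) l i).integral_eq]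
  simp [hn]

lemma errorVariance_eq (h : LinearModel P X Y βstar K KX Cε δ) (i : Fin n) :
    ∫ ω, modelResidual (X ω) (Y ω) βstar i ^ 2 ∂P = errorVariance P X Y βstar := by
  have hn : (n : ℝ) ≠ 0 := by exact_mod_cast (Fin.pos i).ne'
  rw [errorVariance, Finset.sum_congr rfl fun l _ =>
      (h.identDistrib_comp (φ := fun p => p.2 ^ 2) (by fun_prop) l i).integral_eq]
  simp [hn]

lemma le_errorVariance (h : LinearModel P X Y βstar K KX Cε δ) (i : Fin n) :
    Cε ≤ errorVariance P X Y βstar := by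
  rw [← h.errorVariance_eq i, ← variance_of_integral_eq_zero (h.aemeasurable_error i)
    (h.error_mean i)]
  exact h.error_variance i

variable [IsProbabilityMeasure P] {a : ℝ}

lemma expSqBound_design (h : LinearModel P X Y βstar K KX Cε δ) (hKX : 0 < KX) (ha0 : 0 ≤ a)
    (ha : a * (4 * Real.exp 1 * KX ^ 2) ≤ 1) (i : Fin n) (j : Fin d) :
    ExpSqBound a (fun ω => X ω i j) P :=
  expSqBound_of_psiNorm hKX (h.aemeasurable_design i j) (h.design_subGaussian i j) ha0 ha

lemma expSqBound_error (h : LinearModel P X Y βstar K KX Cε δ) (hK : 0 < K) (ha0 : 0 ≤ a)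
    (ha : a * (4 * Real.exp 1 * K ^ 2) ≤ 1) (i : Fin n) :
    ExpSqBound a (fun ω => modelResidual (X ω) (Y ω) βstar i) P :=
  expSqBound_of_psiNorm hK (h.aemeasurable_error i) (h.error_subGaussian i) ha0 ha

end LinearModel

lemma transpose_secondMoment (P : Measure Ω) (X : Ω → Matrix (Fin n) (Fin d) ℝ) :
    (secondMoment P X)ᵀ = secondMoment P X := by
  ext j k
  simp [secondMoment, Matrix.mul_apply, mul_comm]

/-- Subtracting `δ` times the identity shifts the spectrum to the nonnegative half-line, so the
difference is positive semidefinite. -/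
lemma quadForm_ge_of_spectrum {S : Matrix (Fin d) (Fin d) ℝ} (hS : Sᵀ = S)
    (hspec : ∀ μ ∈ spectrum ℝ S, δ ≤ μ) (x : Fin d → ℝ) : δ * (x ⬝ᵥ x) ≤ x ⬝ᵥ (S *ᵥ x) := by
  have hT : (S - algebraMap ℝ _ δ).IsHermitian := by
    rw [Matrix.IsHermitian, Matrix.conjTranspose_eq_transpose_of_trivial, Matrix.transpose_sub, hS,
      Matrix.algebraMap_eq_diagonal, Matrix.diagonal_transpose]
  have hpsd : (S - algebraMap ℝ _ δ).PosSemidef := by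
    rw [hT.posSemidef_iff_eigenvalues_nonneg]
    intro i
    have h1 := hT.eigenvalues_mem_spectrum_real i
    rw [← spectrum.sub_singleton_eq] at h1
    obtain ⟨y, hy, z, hz, hyz⟩ := Set.mem_sub.1 h1
    rw [Set.mem_singleton_iff.1 hz] at hyz
    have := hspec y hy
    simp only [Pi.zero_apply]
    linarith
  have h2 := hpsd.dotProduct_mulVec_nonneg x
  rw [Matrix.sub_mulVec, dotProduct_sub, Algebra.algebraMap_eq_smul_one, Matrix.smul_mulVec,
    Matrix.one_mulVec, dotProduct_smul] at h2
  simpa using h2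

lemma secondMoment_mulVec_vStar [NeZero d] (hδ : 0 < δ)
    (hS : ∀ x : Fin d → ℝ, δ * (x ⬝ᵥ x) ≤ x ⬝ᵥ (secondMoment P X *ᵥ x)) :
    secondMoment P X *ᵥ vStar P X = e1 d := by
  have hu : IsUnit (secondMoment P X) := by
    refine isUnit_of_close hδ le_rfl hS (fun j l => by simp) ?_
    rw [mul_zero]; positivity
  rw [vStar, Matrix.mulVec_mulVec, Matrix.mul_nonsing_inv _ ((Matrix.isUnit_iff_isUnit_det _).1 hu),
    Matrix.one_mulVec]

/-- Cauchy–Schwarz in the inner product of `S`, applied to `e1` and `v`: their product is 1 and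
their squared lengths are `S 0 0` and `v 0`. This keeps the asymptotic variance away from zero. -/
lemma le_apply_zero_of_mulVec_eq_e1 [NeZero d] {S : Matrix (Fin d) (Fin d) ℝ} (hSt : Sᵀ = S)
    {v : Fin d → ℝ} {b : ℝ} (hδ : 0 < δ)
    (hS : ∀ x : Fin d → ℝ, δ * (x ⬝ᵥ x) ≤ x ⬝ᵥ (S *ᵥ x)) (hv : S *ᵥ v = e1 d)
    (hb : S 0 0 ≤ b) : 1 / b ≤ v 0 := by
  have h00 : e1 d ⬝ᵥ (S *ᵥ e1 d) = S 0 0 := by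
    rw [dotProduct_comm, dotProduct_e1]; simp [e1]
  have hpos : 0 < S 0 0 := by
    have := hS (e1 d)
    rw [h00, dotProduct_e1] at this
    simp only [e1, Pi.single_eq_same, mul_one] at this
    linarith
  have hx : 0 ≤ (e1 d - S 0 0 • v) ⬝ᵥ (S *ᵥ (e1 d - S 0 0 • v)) :=
    (mul_nonneg hδ.le (dotProduct_self_nonneg' _)).trans (hS _)
  have hve : v ⬝ᵥ (S *ᵥ e1 d) = 1 := by
    rw [Matrix.dotProduct_mulVec, ← Matrix.mulVec_transpose, hSt, hv, dotProduct_e1]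
    simp [e1]
  rw [Matrix.mulVec_sub, Matrix.mulVec_smul, hv, sub_dotProduct, dotProduct_sub, dotProduct_sub,
    h00, smul_dotProduct, smul_dotProduct, dotProduct_smul, dotProduct_smul, hve, dotProduct_e1,
    dotProduct_e1] at hx
  simp only [e1, Pi.single_eq_same, smul_eq_mul] at hx
  have h1 : 1 ≤ S 0 0 * v 0 := by nlinarith
  have h2 : 1 / S 0 0 ≤ v 0 := by rw [div_le_iff₀ hpos]; linarith
  exact (one_div_le_one_div_of_le hpos hb).trans h2

lemma LinearModel.integral_dotProduct_sq (h : LinearModel P X Y βstar K KX Cε δ) {a : ℝ} (ha : 0 < a)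
    (hX : ∀ i j, ExpSqBound a (fun ω => X ω i j) P) (i : Fin n) (v : Fin d → ℝ) :
    ∫ ω, (X ω i ⬝ᵥ v) ^ 2 ∂P = v ⬝ᵥ (secondMoment P X *ᵥ v) := by
  have h1 : ∀ ω, (X ω i ⬝ᵥ v) ^ 2 = ∑ j, ∑ k, v j * v k * (X ω i j * X ω i k) := fun ω => by
    rw [sq, dotProduct, Finset.sum_mul_sum]
    exact Finset.sum_congr rfl fun j _ => Finset.sum_congr rfl fun k _ => by ring
  have hi : ∀ j k, Integrable (fun ω => v j * v k * (X ω i j * X ω i k)) P := fun j k =>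
    ((hX i j).integrable_mul ha (hX i k)).const_mul _
  simp_rw [h1]
  rw [integral_finsetSum _ fun j _ => integrable_finsetSum _ fun k _ => hi j k]
  simp only [dotProduct, Matrix.mulVec, Finset.mul_sum]
  refine Finset.sum_congr rfl fun j _ => ?_
  rw [integral_finsetSum _ fun k _ => hi j k]
  refine Finset.sum_congr rfl fun k _ => ?_
  rw [integral_const_mul, h.secondMoment_apply ha hX i]
  ring

/-- Jensen's inequality with weights `|v j|`, carried out as two applications of Cauchy–Schwarz.
Coordinatewise moments and the ℓ¹ norm then suffice, with constants free of the dimension. -/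
lemma abs_dotProduct_pow_four_le (x v : Fin d → ℝ) :
    (x ⬝ᵥ v) ^ 4 ≤ l1Norm v ^ 3 * ∑ j, |v j| * x j ^ 4 := by
  have cs : ∀ y : Fin d → ℝ, (∑ j, |v j| * |y j|) ^ 2 ≤ l1Norm v * ∑ j, |v j| * y j ^ 2 := by
    intro y
    have := Finset.sum_mul_sq_le_sq_mul_sq Finset.univ (fun j => √|v j|) fun j => √|v j| * |y j|
    simp only [mul_pow, Real.sq_sqrt (abs_nonneg _), sq_abs, ← mul_assoc,
      Real.mul_self_sqrt (abs_nonneg _)] at this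
    exact this
  have h1 : |x ⬝ᵥ v| ≤ ∑ j, |v j| * |x j| := by
    refine (Finset.abs_sum_le_sum_abs _ _).trans_eq (Finset.sum_congr rfl fun j _ => ?_)
    rw [abs_mul, mul_comm]
  have h2 := cs x
  have h3 := cs fun j => x j ^ 2
  simp only [abs_pow, sq_abs, ← pow_mul] at h3
  have hl := l1Norm_nonneg v
  calc (x ⬝ᵥ v) ^ 4 = (|x ⬝ᵥ v| ^ 2) ^ 2 := by rw [sq_abs]; ring
    _ ≤ ((∑ j, |v j| * |x j|) ^ 2) ^ 2 := by gcongr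
    _ ≤ (l1Norm v * ∑ j, |v j| * x j ^ 2) ^ 2 := by gcongr
    _ = l1Norm v ^ 2 * (∑ j, |v j| * x j ^ 2) ^ 2 := by ring
    _ ≤ l1Norm v ^ 2 * (l1Norm v * ∑ j, |v j| * x j ^ (2 * 2)) := by gcongr
    _ = _ := by ring

lemma integral_dotProduct_pow_four_le {Z : Ω → Fin d → ℝ} {a M : ℝ} (ha : 0 < a)
    (hZ : ∀ j, ExpSqBound a (fun ω => Z ω j) P) {v : Fin d → ℝ} (hM : l1Norm v ≤ M) :
    Integrable (fun ω => (Z ω ⬝ᵥ v) ^ 4) P ∧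
      ∫ ω, (Z ω ⬝ᵥ v) ^ 4 ∂P ≤ 4 * M ^ 4 / a ^ 2 := by
  have hl := l1Norm_nonneg v
  have hi1 : ∀ j, Integrable (fun ω => |v j| * Z ω j ^ 4) P := fun j =>
    ((hZ j).integrable_pow_four ha).1.const_mul _
  have hi : Integrable (fun ω => l1Norm v ^ 3 * ∑ j, |v j| * Z ω j ^ 4) P :=
    (integrable_finsetSum _ fun j _ => hi1 j).const_mul _
  have hmeas : AEMeasurable (fun ω => Z ω ⬝ᵥ v) P := by
    have := fun j => (hZ j).aemeasurable
    unfold dotProduct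
    fun_prop
  have hi4 : Integrable (fun ω => (Z ω ⬝ᵥ v) ^ 4) P := by
    refine hi.mono' (hmeas.pow_const 4).aestronglyMeasurable (ae_of_all _ fun ω => ?_)
    rw [Real.norm_eq_abs, abs_of_nonneg (by positivity)]
    exact abs_dotProduct_pow_four_le _ _
  refine ⟨hi4, (integral_mono hi4 hi fun ω => abs_dotProduct_pow_four_le _ _).trans ?_⟩
  rw [integral_const_mul, integral_finsetSum _ fun j _ => hi1 j]
  simp_rw [integral_const_mul]
  calc l1Norm v ^ 3 * ∑ j, |v j| * ∫ ω, Z ω j ^ 4 ∂P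
      ≤ l1Norm v ^ 3 * ∑ j, |v j| * (4 / a ^ 2) := by
        gcongr with j
        exact ((hZ j).integrable_pow_four ha).2
    _ = 4 * l1Norm v ^ 4 / a ^ 2 := by rw [← Finset.sum_mul, ← l1Norm]; ring
    _ ≤ _ := by gcongr

end Model

/-! ### Moments of the score and probability of a good sample. -/

namespace LinearModel

variable {n d : ℕ} {Ω : Type*} [MeasurableSpace Ω] {P : Measure Ω}
  {X : Ω → Matrix (Fin n) (Fin d) ℝ} {Y : Ω → Fin n → ℝ} {βstar : Fin d → ℝ}
  {K KX Cε δ a : ℝ}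

lemma integral_design_mul_error (h : LinearModel P X Y βstar K KX Cε δ) (v : Fin d → ℝ)
    (i : Fin n) : ∫ ω, (X ω i ⬝ᵥ v) * modelResidual (X ω) (Y ω) βstar i ∂P = 0 := by
  have hv : Measurable fun x : Fin d → ℝ => x ⬝ᵥ v := by unfold dotProduct; fun_prop
  have hind := ((h.error_indep_design i).comp measurable_id hv).symm
  have hm : AEMeasurable (fun ω => X ω i ⬝ᵥ v) P :=
    (h.identDistrib_comp (φ := fun p => p.1 ⬝ᵥ v) (hv.comp measurable_fst) i i).aemeasurable_fst
  have := hind.integral_fun_mul_eq_mul_integral hm.aestronglyMeasurable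
    (h.aemeasurable_error i).aestronglyMeasurable
  refine this.trans ?_
  change _ * ∫ ω, modelResidual (X ω) (Y ω) βstar i ∂P = 0
  rw [h.error_mean i, mul_zero]

lemma integral_design_pow_mul_error_pow (h : LinearModel P X Y βstar K KX Cε δ) (v : Fin d → ℝ)
    (i : Fin n) (p : ℕ) :
    ∫ ω, ((X ω i ⬝ᵥ v) * modelResidual (X ω) (Y ω) βstar i) ^ p ∂P =
      (∫ ω, (X ω i ⬝ᵥ v) ^ p ∂P) * ∫ ω, modelResidual (X ω) (Y ω) βstar i ^ p ∂P := by
  have hv : Measurable fun x : Fin d → ℝ => (x ⬝ᵥ v) ^ p := by unfold dotProduct; fun_prop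
  have hind := ((h.error_indep_design i).comp (measurable_id.pow_const p) hv).symm
  have hm : AEMeasurable (fun ω => (X ω i ⬝ᵥ v) ^ p) P :=
    (h.identDistrib_comp (φ := fun q => (q.1 ⬝ᵥ v) ^ p)
      (hv.comp measurable_fst) i i).aemeasurable_fst
  have := hind.integral_fun_mul_eq_mul_integral hm.aestronglyMeasurable
    ((h.aemeasurable_error i).pow_const p).aestronglyMeasurable
  simp_rw [mul_pow]
  exact this

lemma integrable_design_pow_four_mul (h : LinearModel P X Y βstar K KX Cε δ) (ha : 0 < a)
    (hX : ∀ i j, ExpSqBound a (fun ω => X ω i j) P)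
    (hE : ∀ i, ExpSqBound a (fun ω => modelResidual (X ω) (Y ω) βstar i) P) (v : Fin d → ℝ)
    (i : Fin n) :
    Integrable (fun ω => ((X ω i ⬝ᵥ v) * modelResidual (X ω) (Y ω) βstar i) ^ 4) P := by
  have hv : Measurable fun x : Fin d → ℝ => (x ⬝ᵥ v) ^ 4 := by unfold dotProduct; fun_prop
  have hind := ((h.error_indep_design i).comp (measurable_id.pow_const 4) hv).symm
  have := hind.integrable_mul (integral_dotProduct_pow_four_le ha (hX i) (le_refl (l1Norm v))).1
    ((hE i).integrable_pow_four ha).1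
  refine this.congr (ae_of_all _ fun ω => ?_)
  simp [mul_pow]

variable [IsProbabilityMeasure P]

/-- A union bound over `d + d ^ 2 ≤ 2 * d ^ 2` coordinates, each an average of products of
sub-Gaussian variables. -/
lemma measureReal_not_goodSample_le (h : LinearModel P X Y βstar K KX Cε δ) (hn : 1 ≤ n)
    (hd : 1 ≤ d) (ha : 0 < a) (hX : ∀ i j, ExpSqBound a (fun ω => X ω i j) P)
    (hE : ∀ i, ExpSqBound a (fun ω => modelResidual (X ω) (Y ω) βstar i) P) {u : ℝ}
    (hu0 : 0 ≤ u) (hu : u ≤ 16 / a) :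
    P.real {ω | ¬ GoodSample (X ω) (modelResidual (X ω) (Y ω) βstar) (secondMoment P X) u} ≤
      4 * d ^ 2 * Real.exp (-(a ^ 2 / (64 * Real.exp 2) * n * u ^ 2)) := by
  set b := Real.exp (-(a ^ 2 / (64 * Real.exp 2) * n * u ^ 2)) with hb
  have hb0 : 0 < b := Real.exp_pos _
  have h1 : ∀ j, P.real {ω | u ≤ |noiseScore (X ω) (modelResidual (X ω) (Y ω) βstar) j|}
      ≤ 2 * b := fun j => by
    have := measureReal_abs_mean_mul_sub_ge_le hn (m := 0) (u := u) ha (fun i => hX i j) hE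
      (h.iIndepFun_comp (φ := fun p => p.1 j * p.2) (by fun_prop))
      (fun i => by simpa using h.integral_design_mul_error (Pi.single j 1) i) hu0 hu
    simpa only [noiseScore_apply, sub_zero] using this
  have h2 : ∀ j k, P.real {ω | u ≤ |(sampleSecondMoment (X ω) - secondMoment P X) j k|}
      ≤ 2 * b := fun j k => by
    have := measureReal_abs_mean_mul_sub_ge_le hn (m := secondMoment P X j k) (u := u) ha
      (fun i => hX i j) (fun i => hX i k)
      (h.iIndepFun_comp (φ := fun p => p.1 j * p.1 k) (by fun_prop))
      (fun i => h.secondMoment_apply ha hX i j k) hu0 hu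
    simpa only [Matrix.sub_apply, sampleSecondMoment_apply] using this
  have hsub : {ω | ¬ GoodSample (X ω) (modelResidual (X ω) (Y ω) βstar) (secondMoment P X) u} ⊆
      (⋃ j, {ω | u ≤ |noiseScore (X ω) (modelResidual (X ω) (Y ω) βstar) j|}) ∪
        ⋃ p : Fin d × Fin d,
          {ω | u ≤ |(sampleSecondMoment (X ω) - secondMoment P X) p.1 p.2|} := by
    intro ω hω
    by_contra hcon
    simp only [Set.mem_union, Set.mem_iUnion, Set.mem_ofPred_eq, not_or, not_exists, not_le]
      at hcon
    exact hω ⟨fun j => (hcon.1 j).le, fun j l => (hcon.2 (j, l)).le⟩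
  have hd' : (1 : ℝ) ≤ d := by exact_mod_cast hd
  refine (measureReal_mono (μ := P) hsub).trans ((measureReal_union_le _ _).trans ?_)
  calc _ ≤ ∑ _j : Fin d, 2 * b + ∑ _p : Fin d × Fin d, 2 * b :=
        add_le_add ((measureReal_iUnion_fintype_le _).trans (Finset.sum_le_sum fun j _ => h1 j))
          ((measureReal_iUnion_fintype_le _).trans (Finset.sum_le_sum fun p _ => h2 p.1 p.2))
    _ = (d + d ^ 2) * (2 * b) := by simp; ring
    _ ≤ (d ^ 2 + d ^ 2) * (2 * b) := by
        gcongr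
        nlinarith
    _ = _ := by ring

lemma measureReal_error_sq_le (h : LinearModel P X Y βstar K KX Cε δ) (hn : 1 ≤ n)
    (ha : 0 < a) (hE : ∀ i, ExpSqBound a (fun ω => modelResidual (X ω) (Y ω) βstar i) P) {u : ℝ}
    (hu0 : 0 ≤ u) (hu : u ≤ 16 / a) :
    P.real {ω | u ≤ |(n : ℝ)⁻¹ * ∑ i, modelResidual (X ω) (Y ω) βstar i ^ 2
      - errorVariance P X Y βstar|} ≤
      2 * Real.exp (-(a ^ 2 / (64 * Real.exp 2) * n * u ^ 2)) := by
  have := measureReal_abs_mean_mul_sub_ge_le hn (m := errorVariance P X Y βstar) (u := u) ha hE hE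
    (h.iIndepFun_comp (φ := fun p => p.2 * p.2) (by fun_prop))
    (fun i => by simpa only [sq] using h.errorVariance_eq i) hu0 hu
  simpa only [sq] using this

end LinearModel

lemma sqrt_mul_dotProduct_noiseScore {n d : ℕ} (X : Matrix (Fin n) (Fin d) ℝ) (ε : Fin n → ℝ)
    (v : Fin d → ℝ) (c : ℝ) :
    √(n : ℝ) * (v ⬝ᵥ noiseScore X ε) / c = (√(n : ℝ))⁻¹ * ∑ i, (X i ⬝ᵥ v) * ε i / c := by
  have h1 : v ⬝ᵥ noiseScore X ε = (n : ℝ)⁻¹ * ∑ i, (X i ⬝ᵥ v) * ε i := by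
    rw [noiseScore, dotProduct_smul, Matrix.dotProduct_mulVec, Matrix.vecMul_transpose]
    rfl
  have h2 : √(n : ℝ) * (n : ℝ)⁻¹ = (√(n : ℝ))⁻¹ := by
    rcases Nat.eq_zero_or_pos n with rfl | hn
    · simp
    · have hn0 : (0 : ℝ) < n := by exact_mod_cast hn
      have := Real.mul_self_sqrt hn0.le
      field_simp
      rw [sq, this]
  rw [h1, ← Finset.sum_div, ← mul_assoc, h2, mul_div_assoc]

/-! ### Asymptotic normality and Slutsky's theorem. -/

section Sequences

variable {Ω : ℕ → Type*} [∀ n, MeasurableSpace (Ω n)] {P : ∀ n, Measure (Ω n)}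
  [∀ n, IsProbabilityMeasure (P n)]

/-- The normalized noise average along a direction is asymptotically standard normal. -/
lemma tendsto_measureReal_noise_le_cdf {d : ℕ → ℕ} {X : ∀ n, Ω n → Matrix (Fin n) (Fin (d n)) ℝ}
    {Y : ∀ n, Ω n → Fin n → ℝ} {βstar v : ∀ n, Fin (d n) → ℝ} {K KX Cε δ a M κ : ℝ}
    {w : ℕ → ℝ} (hCε : 0 < Cε) (ha : 0 < a) (hκ : 0 < κ)
    (h : ∀ n, 1 ≤ n → LinearModel (P n) (X n) (Y n) (βstar n) K KX Cε δ)
    (hX : ∀ n i j, ExpSqBound a (fun ω => X n ω i j) (P n))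
    (hE : ∀ n i, ExpSqBound a (fun ω => modelResidual (X n ω) (Y n ω) (βstar n) i) (P n))
    (hM : ∀ n, 1 ≤ n → l1Norm (v n) ≤ M)
    (hv : ∀ n, 1 ≤ n → v n ⬝ᵥ (secondMoment (P n) (X n) *ᵥ v n) = w n)
    (hw : ∀ n, 1 ≤ n → κ ≤ w n) (x : ℝ) :
    Tendsto (fun n : ℕ => (P n).real {ω | √(n : ℝ) *
      (v n ⬝ᵥ noiseScore (X n ω) (modelResidual (X n ω) (Y n ω) (βstar n))) /
        √(w n * errorVariance (P n) (X n) (Y n) (βstar n)) ≤ x}) atTop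
      (𝓝 (cdf (gaussianReal 0 1) x)) := by
  set c : ℕ → ℝ := fun n => √(w n * errorVariance (P n) (X n) (Y n) (βstar n)) with hc
  simp_rw [sqrt_mul_dotProduct_noiseScore]
  -- An index is itself a proof that the sample is nonempty, so the model is available wherever a
  -- summand exists and `n = 0` needs no case.
  have hpos : ∀ n, Fin n → 1 ≤ n := fun n i => Fin.pos i
  have hφ : ∀ n, Measurable fun p : (Fin (d n) → ℝ) × ℝ => (p.1 ⬝ᵥ v n) * p.2 / c n := fun n => by
    unfold dotProduct; fun_prop
  have hlow : ∀ n, Fin n → κ * Cε ≤ w n * errorVariance (P n) (X n) (Y n) (βstar n) :=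
    fun n i => mul_le_mul (hw n (hpos n i)) ((h n (hpos n i)).le_errorVariance i) hCε.le
      (hκ.le.trans (hw n (hpos n i)))
  have hc2 : ∀ n, Fin n → c n ^ 2 = w n * errorVariance (P n) (X n) (Y n) (βstar n) :=
    fun n i => Real.sq_sqrt ((mul_pos hκ hCε).le.trans (hlow n i))
  refine tendsto_measureReal_sum_le_cdf
    (W := fun n i ω => (X n ω i ⬝ᵥ v n) * modelResidual (X n ω) (Y n ω) (βstar n) i / c n)
    (C := 4 * M ^ 4 / a ^ 2 * (4 / a ^ 2) / (κ * Cε) ^ 2) ?_ ?_ ?_ ?_ ?_ ?_ ?_ x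
  · exact fun n i => ((h n (hpos n i)).identDistrib_comp (hφ n) i i).aemeasurable_fst
  · exact fun n hn => (h n hn).iIndepFun_comp (hφ n)
  · exact fun n i j => (h n (hpos n i)).identDistrib_comp (hφ n) i j
  · intro n i
    simp only [div_pow]
    exact ((h n (hpos n i)).integrable_design_pow_four_mul ha (hX n) (hE n) _ i).div_const _
  · intro n i
    have h4 := (integral_dotProduct_pow_four_le (Z := fun ω => X n ω i) ha (hX n i)
      (hM n (hpos n i))).2
    have h4' := ((hE n i).integrable_pow_four ha).2
    have hM0 : 0 ≤ M := (l1Norm_nonneg _).trans (hM n (hpos n i))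
    simp only [div_pow]
    rw [integral_div, (h n (hpos n i)).integral_design_pow_mul_error_pow,
      show c n ^ 4 = (c n ^ 2) ^ 2 by ring, hc2 n i]
    have e1 : 0 ≤ ∫ ω, modelResidual (X n ω) (Y n ω) (βstar n) i ^ 4 ∂(P n) :=
      integral_nonneg fun ω => by positivity
    have := hlow n i
    gcongr
  · intro n i
    rw [integral_div, (h n (hpos n i)).integral_design_mul_error, zero_div]
  · intro n i
    simp only [div_pow]
    rw [integral_div, (h n (hpos n i)).integral_design_pow_mul_error_pow, hc2 n i,
      (h n (hpos n i)).integral_dotProduct_sq ha (hX n) i, (h n (hpos n i)).errorVariance_eq i,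
      hv n (hpos n i)]
    exact div_self ((mul_pos hκ hCε).trans_le (hlow n i)).ne'

lemma continuous_cdf_gaussianReal (μ : ℝ) {v : NNReal} (hv : v ≠ 0) :
    Continuous (cdf (gaussianReal μ v)) := by
  rw [continuous_iff_continuousAt]
  intro x
  have := nullSingletonClass_gaussianReal (μ := μ) hv
  rw [(monotone_cdf _).continuousAt_iff_leftLim_eq_rightLim, StieltjesFunction.rightLim_eq]
  have h1 := StieltjesFunction.measure_singleton (cdf (gaussianReal μ v)) x
  rw [measure_cdf, measure_singleton, eq_comm, ENNReal.ofReal_eq_zero, sub_nonpos] at h1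
  exact le_antisymm ((monotone_cdf _).leftLim_le le_rfl) h1

/-- Slutsky's theorem for distribution functions, for possibly nonmeasurable statistics on
varying probability spaces. -/
lemma tendsto_measureReal_le_of_close {U Z : ∀ n, Ω n → ℝ} {F : ℝ → ℝ} {t : ℝ}
    (hF : ContinuousAt F t)
    (hZ : ∀ x, Tendsto (fun n => (P n).real {ω | Z n ω ≤ x}) atTop (𝓝 (F x)))
    (h : ∀ η > 0, ∀ᶠ n in atTop, ∃ B : Set (Ω n), (P n).real B ≤ η ∧ ∀ ω ∉ B,
      ∃ R, 0 ≤ R ∧ |R - 1| ≤ η ∧ |U n ω * R - Z n ω| ≤ η) :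
    Tendsto (fun n => (P n).real {ω | U n ω ≤ t}) atTop (𝓝 (F t)) := by
  rw [Metric.tendsto_nhds]
  intro ε hε
  obtain ⟨ρ, hρ, hFρ⟩ := Metric.continuousAt_iff.1 hF (ε / 4) (by positivity)
  set η := min (ε / 4) (ρ / (4 * (1 + |t|))) with hη
  have ht : 0 < 1 + |t| := by positivity
  have hη0 : 0 < η := by positivity
  -- Replacing `U` by `Z` shifts the threshold by at most `(1 + |t|) * η`. The factor 2 supplies
  -- strictness in the second inclusion, where multiplying by a possibly vanishing `R` loses it.
  set σ := 2 * (1 + |t|) * η with hσ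
  have hσρ : σ < ρ := by
    have h1 : η ≤ ρ / (4 * (1 + |t|)) := min_le_right _ _
    calc σ ≤ 2 * (1 + |t|) * (ρ / (4 * (1 + |t|))) := by rw [hσ]; gcongr
      _ = ρ / 2 := by field_simp; ring
      _ < ρ := by linarith
  have hσ0 : 0 < σ := by positivity
  have hFup : |F (t + σ) - F t| < ε / 4 :=
    hFρ (by rw [Real.dist_eq, add_sub_cancel_left, abs_of_pos hσ0]; exact hσρ)
  have hFlo : |F (t - σ) - F t| < ε / 4 :=
    hFρ (by rw [Real.dist_eq, sub_sub_cancel_left, abs_neg, abs_of_pos hσ0]; exact hσρ)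
  filter_upwards [h η hη0, Metric.tendsto_nhds.1 (hZ (t + σ)) (ε / 4) (by positivity),
    Metric.tendsto_nhds.1 (hZ (t - σ)) (ε / 4) (by positivity)] with n hn hup hlo
  obtain ⟨B, hB, hB'⟩ := hn
  have htR : ∀ R : ℝ, |R - 1| ≤ η → |t * R - t| ≤ |t| * η := fun R hR => by
    rw [show t * R - t = t * (R - 1) by ring, abs_mul]
    gcongr
  have hσ' : σ = 2 * (η + |t| * η) := by rw [hσ]; ring
  have s1 : {ω | U n ω ≤ t} ⊆ {ω | Z n ω ≤ t + σ} ∪ B := by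
    intro ω hω
    by_cases hωB : ω ∈ B
    · exact Or.inr hωB
    · left
      obtain ⟨R, hR0, hR1, hUR⟩ := hB' ω hωB
      have h1 := mul_le_mul_of_nonneg_right (show U n ω ≤ t from hω) hR0
      have h2 := (abs_le.1 (htR R hR1)).2
      have h3 := (abs_le.1 hUR).1
      change Z n ω ≤ t + σ
      linarith
  have s2 : {ω | Z n ω ≤ t - σ} ⊆ {ω | U n ω ≤ t} ∪ B := by
    intro ω hω
    by_cases hωB : ω ∈ B
    · exact Or.inr hωB
    · left
      obtain ⟨R, hR0, hR1, hUR⟩ := hB' ω hωB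
      by_contra hcon
      have hlt : t < U n ω := not_le.1 hcon
      have hZω : Z n ω ≤ t - σ := hω
      have h2 := (abs_le.1 (htR R hR1)).1
      have h3 := (abs_le.1 hUR).2
      have h1 := mul_le_mul_of_nonneg_right hlt.le hR0
      linarith
  have p1 := (measureReal_mono (μ := P n) s1).trans (measureReal_union_le _ _)
  have p2 := (measureReal_mono (μ := P n) s2).trans (measureReal_union_le _ _)
  have hηε : η ≤ ε / 4 := min_le_left _ _
  rw [Real.dist_eq, abs_lt] at hup hlo ⊢
  rw [abs_lt] at hFup hFlo
  constructor <;> linarith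

end Sequences

/-! ### Deviation and sparsity levels across the dimension cutoff. -/

section Rates

/-- Deviation level: parametric in bounded dimension, and with a logarithmic factor otherwise. -/
noncomputable def deviationLevel (D : ℕ) (T A₁ : ℝ) (d n : ℕ) : ℝ :=
  if d ≤ D then T / √(n : ℝ) else A₁ * √(Real.log d / n)

/-- Sparsity level, replaced by a bound on the dimension when the latter is bounded. -/
noncomputable def sparsityLevel (D : ℕ) (m : ℝ) (d : ℕ) : ℝ := if d ≤ D then D else m

lemma log_natCast_nonneg (d : ℕ) : 0 ≤ Real.log d := by
  rcases Nat.eq_zero_or_pos d with rfl | h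
  · simp
  · exact Real.log_nonneg (by exact_mod_cast h)

/-- Below the cutoff `log d ≤ D`, so the deviation is of order `1 / √n` and the sparsity level is
constant. Above it the products reduce to the assumed rate `m * log d / √n`. -/
lemma rate_bounds {D d n : ℕ} {T A₁ B M m : ℝ} (hD : 1 ≤ D) (hn : 1 ≤ n) (hT : 0 ≤ T)
    (hA₁ : 0 ≤ A₁) (hB : 0 ≤ B) (hM : 0 ≤ M) (hm : 0 ≤ m) (hd : 1 ≤ d) :
    let C := B + (1 + M) * (A₁ + T)
    let g := B * √(Real.log d / n) + (1 + M) * deviationLevel D T A₁ d n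
    let k := sparsityLevel D m d
    g ≤ C * (√(Real.log d / n) + 1 / √(n : ℝ)) ∧
      k * g ≤ 2 * C * D ^ 2 * (m * Real.log d / √(n : ℝ) + 1 / √(n : ℝ)) ∧
      √(n : ℝ) * (k * g ^ 2) ≤ C ^ 2 * D ^ 3 * (m * Real.log d / √(n : ℝ) + 1 / √(n : ℝ)) := by
  intro C g k
  have hl := log_natCast_nonneg d
  have hn0 : (0 : ℝ) < n := by exact_mod_cast hn
  have hs : 0 < √(n : ℝ) := Real.sqrt_pos.2 hn0
  have hC : 0 ≤ C := by positivity
  have hD1 : (1 : ℝ) ≤ D := by exact_mod_cast hD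
  have hsq : √(Real.log d / n) = √(Real.log d) / √(n : ℝ) := Real.sqrt_div hl _
  have hq : 0 ≤ m * Real.log d / √(n : ℝ) := by positivity
  have hi : 0 ≤ 1 / √(n : ℝ) := by positivity
  have hBC : B ≤ C := by
    have : 0 ≤ (1 + M) * (A₁ + T) := by positivity
    simp only [C]; linarith
  by_cases hdD : d ≤ D
  · have hk : k = D := if_pos hdD
    have hu : deviationLevel D T A₁ d n = T / √(n : ℝ) := if_pos hdD
    have hlD : √(Real.log d) ≤ D := by
      have h1 : Real.log d ≤ (D : ℝ) := by
        have h2 : (d : ℝ) ≤ D := by exact_mod_cast hdD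
        have h3 := Real.log_le_sub_one_of_pos (show (0 : ℝ) < d by exact_mod_cast hd)
        linarith
      rw [Real.sqrt_le_left (by linarith)]
      nlinarith
    have hg1 : g ≤ C * (√(Real.log d / n) + 1 / √(n : ℝ)) := by
      have e1 : (1 + M) * T ≤ C := by
        have : 0 ≤ (1 + M) * A₁ := by positivity
        simp only [C]; linarith
      simp only [g, hu]
      calc B * √(Real.log d / n) + (1 + M) * (T / √(n : ℝ))
          = B * √(Real.log d / n) + (1 + M) * T * (1 / √(n : ℝ)) := by ring
        _ ≤ C * √(Real.log d / n) + C * (1 / √(n : ℝ)) := by gcongr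
        _ = _ := by ring
    have hg2 : g ≤ C * D * (1 / √(n : ℝ)) := by
      simp only [g, hu, hsq]
      calc B * (√(Real.log d) / √(n : ℝ)) + (1 + M) * (T / √(n : ℝ))
          ≤ B * (D / √(n : ℝ)) + (1 + M) * (A₁ + T) * (D / √(n : ℝ)) := by
            have : T / √(n : ℝ) ≤ (A₁ + T) * (D / √(n : ℝ)) := by
              rw [← mul_div_assoc]
              gcongr
              nlinarith
            rw [mul_assoc (1 + M)]
            gcongr
        _ = _ := by simp only [C]; ring
    have hg0 : 0 ≤ g := by simp only [g, hu]; positivity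
    refine ⟨hg1, ?_, ?_⟩
    · rw [hk]
      calc (D : ℝ) * g ≤ D * (C * D * (1 / √(n : ℝ))) := by gcongr
        _ = C * D ^ 2 * (1 / √(n : ℝ)) := by ring
        _ ≤ 2 * C * D ^ 2 * (m * Real.log d / √(n : ℝ) + 1 / √(n : ℝ)) := by
          gcongr
          · linarith
          · linarith
    · rw [hk]
      calc √(n : ℝ) * (D * g ^ 2) ≤ √(n : ℝ) * (D * (C * D * (1 / √(n : ℝ))) ^ 2) := by gcongr
        _ = C ^ 2 * D ^ 3 * (1 / √(n : ℝ)) := by field_simp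
        _ ≤ _ := by gcongr; linarith
  · have hk : k = m := if_neg hdD
    have hu : deviationLevel D T A₁ d n = A₁ * √(Real.log d / n) := if_neg hdD
    have hg : g ≤ C * √(Real.log d / n) := by
      have : 0 ≤ (1 + M) * T * √(Real.log d / n) := by positivity
      simp only [g, hu, C]
      linarith
    have hg0 : 0 ≤ g := by simp only [g, hu]; positivity
    -- Holds because `d ≥ 2` gives `log d ≥ 1 / 4`. It lets the sparsity rate control `m * √(log d /
    -- n)` as well.
    have hld : √(Real.log d) ≤ 2 * Real.log d := by
      have h2 : (2 : ℝ) ≤ d := by exact_mod_cast (by omega : 2 ≤ d)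
      have h3 := Real.log_le_log (by norm_num) h2
      have h4 := Real.log_two_gt_d9
      rw [Real.sqrt_le_left (by linarith)]
      nlinarith
    refine ⟨?_, ?_, ?_⟩
    · rw [mul_add]
      have := mul_nonneg hC hi
      linarith
    · rw [hk]
      calc m * g ≤ m * (C * √(Real.log d / n)) := by gcongr
        _ = C * (m * √(Real.log d) / √(n : ℝ)) := by rw [hsq]; ring
        _ ≤ C * (m * (2 * Real.log d) / √(n : ℝ)) := by gcongr
        _ = 2 * C * 1 ^ 2 * (m * Real.log d / √(n : ℝ)) := by ring
        _ ≤ _ := by gcongr; linarith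
    · rw [hk]
      calc √(n : ℝ) * (m * g ^ 2) ≤ √(n : ℝ) * (m * (C * √(Real.log d / n)) ^ 2) := by gcongr
        _ = C ^ 2 * 1 ^ 3 * (m * Real.log d / √(n : ℝ)) := by
            have e1 : √(Real.log d) ^ 2 = Real.log d := Real.sq_sqrt hl
            have e2 : √(n : ℝ) / √(n : ℝ) ^ 2 = 1 / √(n : ℝ) := by field_simp
            rw [hsq, mul_pow, div_pow, e1]
            calc _ = C ^ 2 * m * Real.log d * (√(n : ℝ) / √(n : ℝ) ^ 2) := by ring
              _ = _ := by rw [e2]; ring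
        _ ≤ _ := by gcongr; linarith

/-- Above the cutoff `c * A₁ ^ 2 = 4` turns the exponential into `d ^ (-4)`, which beats the union
bound and leaves `4 / d ^ 2 ≤ 4 / D`. Below it the choice of `T` does the work. -/
lemma four_mul_sq_mul_exp_le {D d n : ℕ} {T A₁ c ε : ℝ} (hD : 1 ≤ D) (hn : 1 ≤ n)
    (hc : c * A₁ ^ 2 = 4) (hDε : 4 / D ≤ ε)
    (hT : 4 * (D : ℝ) ^ 2 * Real.exp (-(c * T ^ 2)) ≤ ε) :
    4 * (d : ℝ) ^ 2 * Real.exp (-(c * n * deviationLevel D T A₁ d n ^ 2)) ≤ ε := by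
  have hn0 : (0 : ℝ) < n := by exact_mod_cast hn
  by_cases hdD : d ≤ D
  · rw [deviationLevel, if_pos hdD, div_pow, Real.sq_sqrt hn0.le]
    refine le_trans ?_ hT
    rw [show c * n * (T ^ 2 / n) = c * T ^ 2 by field_simp]
    gcongr
  · rw [deviationLevel, if_neg hdD, mul_pow,
      Real.sq_sqrt (div_nonneg (log_natCast_nonneg d) hn0.le),
      show c * n * (A₁ ^ 2 * (Real.log d / n)) = (c * A₁ ^ 2) * Real.log d by field_simp, hc]
    have hDd : (D : ℝ) ≤ d := by exact_mod_cast (by omega : D ≤ d)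
    have hD1 : (1 : ℝ) ≤ D := by exact_mod_cast hD
    have hd0 : (0 : ℝ) < d := by linarith
    have he : Real.exp (-(4 * Real.log d)) = ((d : ℝ) ^ 4)⁻¹ := by
      rw [Real.exp_neg, show (4 : ℝ) * Real.log d = ((4 : ℕ) : ℝ) * Real.log d by norm_num,
        Real.exp_nat_mul, Real.exp_log hd0]
    rw [he]
    refine le_trans ?_ hDε
    calc 4 * (d : ℝ) ^ 2 * ((d : ℝ) ^ 4)⁻¹ = 4 / (d * d) := by field_simp
      _ ≤ 4 / D := by
        gcongr
        nlinarith

end Rates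

/-! ### Choice of constants and assembly. -/

theorem mainTheorem4 (K KX M : ℝ) (hK : 0 < K) (hKX : 0 < KX) (hM : 0 < M) :
    ∃ A₀ : ℝ, 0 < A₀ ∧
      ∀ (Cε δ A : ℝ), 0 < Cε → 0 < δ →
      ∀ (d : ℕ → ℕ) [∀ n, NeZero (d n)]
        (Ω : ℕ → Type*) [∀ n, MeasurableSpace (Ω n)]
        (P : ∀ n, Measure (Ω n)) [∀ n, IsProbabilityMeasure (P n)]
        (X : ∀ n, Ω n → Matrix (Fin n) (Fin (d n)) ℝ)
        (Y : ∀ n, Ω n → Fin n → ℝ)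
        (βstar : ∀ n, Fin (d n) → ℝ)
        (lam lam' : ℕ → ℝ)
        (βhat vhat : ∀ n, Ω n → Fin (d n) → ℝ)
        (θtilde : ∀ n, Ω n → ℝ),
      -- the linear model with fixed constants, and bounded `‖v*‖₁`
      (∀ n, 1 ≤ n → LinearModel (P n) (X n) (Y n) (βstar n) K KX Cε δ) →
      (∀ n, 1 ≤ n → l1Norm (vStar (P n) (X n)) ≤ M) →
      -- sparsity and dimension
      Tendsto (fun n : ℕ =>
          (max (hammingNorm (vStar (P n) (X n))) (hammingNorm (βstar n)) : ℝ)
            * Real.log (d n) / √(n : ℝ)) atTop (𝓝 0) →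
      Tendsto (fun n : ℕ => √(Real.log (d n) / n)) atTop (𝓝 0) →
      -- tuning parameters
      (∀ᶠ n : ℕ in atTop, A₀ * √(Real.log (d n) / n) ≤ lam n ∧
        lam n ≤ A * √(Real.log (d n) / n)) →
      (∀ᶠ n : ℕ in atTop, A₀ * √(Real.log (d n) / n) ≤ lam' n ∧
        lam' n ≤ A * √(Real.log (d n) / n)) →
      -- the estimators
      (∀ n, AEMeasurable (βhat n) (P n)) →
      (∀ n, AEMeasurable (vhat n) (P n)) →
      (∀ n, AEMeasurable (θtilde n) (P n)) →
      (∀ n, ∀ᵐ ω ∂(P n), (dantzigSet (X n ω) (Y n ω) (lam n)).Nonempty →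
        IsL1Argmin (dantzigSet (X n ω) (Y n ω) (lam n)) (βhat n ω)) →
      (∀ n, ∀ᵐ ω ∂(P n), (projectionSet (X n ω) (lam' n)).Nonempty →
        IsL1Argmin (projectionSet (X n ω) (lam' n)) (vhat n ω)) →
      (∀ n, ∀ᵐ ω ∂(P n), (∃ θ, IsZRoot (X n ω) (Y n ω) (vhat n ω) (βhat n ω) θ) →
        IsZRoot (X n ω) (Y n ω) (vhat n ω) (βhat n ω) (θtilde n ω)) →
      ∀ t : ℝ, Tendsto (fun n : ℕ =>
          |(P n).real {ω | studentized (X n ω) (Y n ω) (vhat n ω) (βhat n ω) (θtilde n ω)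
              (βstar n 0) ≤ t} - cdf (gaussianReal 0 1) t|) atTop (𝓝 0) := by
  set a : ℝ := 1 / (4 * Real.exp 1 * (K ^ 2 + KX ^ 2)) with ha_def
  have ha : 0 < a := by positivity
  have haK : a * (4 * Real.exp 1 * K ^ 2) ≤ 1 := by
    rw [ha_def, one_div_mul_eq_div, div_le_one (by positivity)]
    gcongr
    have := sq_nonneg KX
    linarith
  have haKX : a * (4 * Real.exp 1 * KX ^ 2) ≤ 1 := by
    rw [ha_def, one_div_mul_eq_div, div_le_one (by positivity)]
    gcongr
    have := sq_nonneg K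
    linarith
  set c : ℝ := a ^ 2 / (64 * Real.exp 2) with hc_def
  have hc : 0 < c := by positivity
  set A₁ : ℝ := √(4 / c) with hA₁_def
  have hA₁ : 0 < A₁ := Real.sqrt_pos.2 (by positivity)
  have hcA : c * A₁ ^ 2 = 4 := by
    rw [hA₁_def, Real.sq_sqrt (by positivity)]; field_simp
  -- With `r = √(log d / n)`, this dominates both `A₁ * r`, needed for feasibility of `β*`, and `M *
  -- A₁ * r`, needed for feasibility of `v*`.
  refine ⟨(1 + M) * A₁, by positivity, ?_⟩
  intro Cε δ A hCε hδ d _ Ω _ P _ X Y βstar lam lam' βhat vhat θtilde hmod hvM hsparse hdim hlam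
    hlam' _ _ _ hβ hv hθ t
  have hX : ∀ n i j, ExpSqBound a (fun ω => X n ω i j) (P n) := fun n i j =>
    (hmod n (Fin.pos i)).expSqBound_design hKX ha.le haKX i j
  have hE : ∀ n i, ExpSqBound a (fun ω => modelResidual (X n ω) (Y n ω) (βstar n) i) (P n) :=
    fun n i => (hmod n (Fin.pos i)).expSqBound_error hK ha.le haK i
  have hS : ∀ n, 1 ≤ n → ∀ x : Fin (d n) → ℝ,
      δ * (x ⬝ᵥ x) ≤ x ⬝ᵥ (secondMoment (P n) (X n) *ᵥ x) := fun n hn =>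
    quadForm_ge_of_spectrum (transpose_secondMoment _ _) (hmod n hn).eigenvalue_ge
  have hSv : ∀ n, 1 ≤ n → secondMoment (P n) (X n) *ᵥ vStar (P n) (X n) = e1 (d n) :=
    fun n hn => secondMoment_mulVec_vStar hδ (hS n hn)
  have hv0 : ∀ n, 1 ≤ n → a / 2 ≤ vStar (P n) (X n) 0 := by
    intro n hn
    have h00 : secondMoment (P n) (X n) 0 0 ≤ 2 / a := by
      have h1 := (hX n ⟨0, hn⟩ 0).abs_integral_mul_le ha (hX n ⟨0, hn⟩ 0)
      rw [(hmod n hn).secondMoment_apply ha (hX n)] at h1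
      rw [le_div_iff₀ ha, mul_comm]
      exact (mul_le_mul_of_nonneg_left (le_abs_self _) ha.le).trans h1
    have := le_apply_zero_of_mulVec_eq_e1 (transpose_secondMoment _ _) hδ (hS n hn) (hSv n hn) h00
    rwa [one_div_div] at this
  have hZ := tendsto_measureReal_noise_le_cdf (v := fun n => vStar (P n) (X n))
    (w := fun n => vStar (P n) (X n) 0) hCε ha (half_pos ha) hmod hX hE hvM
    (fun n hn => by rw [hSv n hn, dotProduct_e1]) hv0
  obtain ⟨C, hC, hclose⟩ := exists_studentized_close (κ := a / 2) hδ hM.le (half_pos ha) hCε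
  suffices h : Tendsto (fun n : ℕ => (P n).real {ω | studentized (X n ω) (Y n ω) (vhat n ω)
      (βhat n ω) (θtilde n ω) (βstar n 0) ≤ t}) atTop (𝓝 (cdf (gaussianReal 0 1) t)) by
    have := (h.sub_const (cdf (gaussianReal 0 1) t)).abs
    simpa using this
  refine tendsto_measureReal_le_of_close (continuous_cdf_gaussianReal 0 one_ne_zero).continuousAt
    hZ fun η hη => ?_
  -- The cutoff, and then `T`, depend on the tolerance `η`: large dimensions fail with probability
  -- at most `4 / D`, small ones by the exponential bound in `T`.
  obtain ⟨D, hD⟩ := exists_nat_ge (max 1 (4 / (η / 2)))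
  have hD1 : 1 ≤ D := by exact_mod_cast (le_max_left _ _).trans hD
  have hDη : 4 / (D : ℝ) ≤ η / 2 := by
    have h1 := (le_max_right _ _).trans hD
    rw [div_le_iff₀ (by positivity)] at h1 ⊢
    linarith
  have hexp0 : ∀ b : ℝ, Tendsto (fun n : ℕ => b * Real.exp (-(c * n ^ 2))) atTop (𝓝 0) := by
    intro b
    have h1 : Tendsto (fun n : ℕ => c * (n : ℝ) ^ 2) atTop atTop :=
      ((tendsto_pow_atTop two_ne_zero).comp tendsto_natCast_atTop_atTop).const_mul_atTop hc
    simpa using (Real.tendsto_exp_neg_atTop_nhds_zero.comp h1).const_mul b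
  obtain ⟨T, hT⟩ := ((hexp0 (4 * (D : ℝ) ^ 2)).eventually_le_const (half_pos hη)).exists
  -- The four bounds serve, in order, smallness in the studentization, the range of the tail bounds,
  -- closeness within `η`, and restricted strong convexity.
  set τ : ℝ := min (min 1 (16 / a)) (min (min 1 η / C) (δ / 8)) with hτ_def
  have hτ : 0 < τ := by positivity
  have hτ1 : τ ≤ 1 := (min_le_left _ _).trans (min_le_left _ _)
  have hτa : τ ≤ 16 / a := (min_le_left _ _).trans (min_le_right _ _)
  have hτC : C * τ ≤ min 1 η := by
    have : τ ≤ min 1 η / C := (min_le_right _ _).trans (min_le_left _ _)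
    rwa [le_div_iff₀' hC] at this
  have hτδ : τ ≤ δ / 8 := (min_le_right _ _).trans (min_le_right _ _)
  have hsqrt : Tendsto (fun n : ℕ => 1 / √(n : ℝ)) atTop (𝓝 0) := by
    simpa [Function.comp_def] using tendsto_inv_atTop_zero.comp
      (Real.tendsto_sqrt_atTop.comp tendsto_natCast_atTop_atTop)
  have hgood0 : Tendsto (fun n : ℕ => 2 * Real.exp (-(c * n * τ ^ 2))) atTop (𝓝 0) := by
    have h1 : Tendsto (fun n : ℕ => c * (n : ℝ) * τ ^ 2) atTop atTop :=
      (tendsto_natCast_atTop_atTop.const_mul_atTop hc).atTop_mul_const (by positivity)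
    simpa using (Real.tendsto_exp_neg_atTop_nhds_zero.comp h1).const_mul 2
  -- The sign of `A` is not assumed, hence the absolute value.
  set C' : ℝ := |A| + (1 + M) * (A₁ + T) with hC'
  have l1 := (hdim.add hsqrt).const_mul C'
  have l2 := (hsparse.add hsqrt).const_mul (2 * C' * D ^ 2)
  have l3 := (hsparse.add hsqrt).const_mul (C' ^ 2 * D ^ 3)
  rw [add_zero, mul_zero] at l1 l2 l3
  filter_upwards [hlam, hlam', l1.eventually_le_const hτ, l2.eventually_le_const hτ,
    l3.eventually_le_const hτ, hgood0.eventually_le_const (half_pos hη), eventually_ge_atTop 1]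
    with n hlamn hlamn' hg hkg hnkg hexpn hn
  have hd1 : 1 ≤ d n := Nat.one_le_iff_ne_zero.2 (NeZero.ne _)
  set m : ℝ := max (hammingNorm (vStar (P n) (X n)) : ℝ) (hammingNorm (βstar n)) with hm_def
  have hm : 0 ≤ m := le_max_of_le_left (Nat.cast_nonneg _)
  set r := √(Real.log (d n) / n) with hr
  have hr0 : 0 ≤ r := Real.sqrt_nonneg _
  set u := deviationLevel D T A₁ (d n) n with hu_def
  have hu0 : 0 ≤ u := by
    rw [hu_def, deviationLevel]; split_ifs <;> positivity
  obtain ⟨b1, b2, b3⟩ := rate_bounds (T := T) hD1 hn (Nat.cast_nonneg T) hA₁.le (abs_nonneg A)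
    hM.le hm hd1
  have hgτ := b1.trans hg
  have hkgτ := b2.trans hkg
  have hnkgτ := b3.trans hnkg
  set g := |A| * r + (1 + M) * u with hg_def
  set k := sparsityLevel D m (d n) with hk_def
  have hug : u ≤ g := by
    have h1 : 0 ≤ |A| * r := by positivity
    have h2 : 0 ≤ M * u := by positivity
    linarith
  have hA₀r : 0 ≤ (1 + M) * A₁ * r := by positivity
  have hAr : A * r ≤ |A| * r := mul_le_mul_of_nonneg_right (le_abs_self A) hr0
  have hcase : (d n : ℝ) ≤ k ∨ ((hammingNorm (vStar (P n) (X n)) : ℝ) ≤ k ∧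
      (hammingNorm (βstar n) : ℝ) ≤ k ∧ u ≤ lam n ∧ M * u ≤ lam' n) := by
    by_cases hdD : d n ≤ D
    · left
      rw [hk_def, sparsityLevel, if_pos hdD]
      exact_mod_cast hdD
    · right
      have hk : k = m := if_neg hdD
      have hu : u = A₁ * r := if_neg hdD
      have hAr1 : 0 ≤ A₁ * r := by positivity
      have hMAr1 : 0 ≤ M * (A₁ * r) := by positivity
      rw [hk, hu]
      exact ⟨le_max_left _ _, le_max_right _ _, by linarith [hlamn.1], by linarith [hlamn'.1]⟩
  -- The exceptional set collects bad samples, atypical error variance, and the null set where an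
  -- almost sure defining property of an estimator fails.
  refine ⟨{ω | ¬ GoodSample (X n ω) (modelResidual (X n ω) (Y n ω) (βstar n))
        (secondMoment (P n) (X n)) u} ∪
      {ω | τ ≤ |(n : ℝ)⁻¹ * ∑ i, modelResidual (X n ω) (Y n ω) (βstar n) i ^ 2
        - errorVariance (P n) (X n) (Y n) (βstar n)|} ∪
      {ω | ¬ (((dantzigSet (X n ω) (Y n ω) (lam n)).Nonempty →
        IsL1Argmin (dantzigSet (X n ω) (Y n ω) (lam n)) (βhat n ω)) ∧
        ((projectionSet (X n ω) (lam' n)).Nonempty →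
        IsL1Argmin (projectionSet (X n ω) (lam' n)) (vhat n ω)) ∧
        ((∃ θ, IsZRoot (X n ω) (Y n ω) (vhat n ω) (βhat n ω) θ) →
        IsZRoot (X n ω) (Y n ω) (vhat n ω) (βhat n ω) (θtilde n ω)))}, ?_, ?_⟩
  · have h3 : (P n).real {ω | ¬ (((dantzigSet (X n ω) (Y n ω) (lam n)).Nonempty →
        IsL1Argmin (dantzigSet (X n ω) (Y n ω) (lam n)) (βhat n ω)) ∧
        ((projectionSet (X n ω) (lam' n)).Nonempty →
        IsL1Argmin (projectionSet (X n ω) (lam' n)) (vhat n ω)) ∧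
        ((∃ θ, IsZRoot (X n ω) (Y n ω) (vhat n ω) (βhat n ω) θ) →
        IsZRoot (X n ω) (Y n ω) (vhat n ω) (βhat n ω) (θtilde n ω)))} = 0 := by
      rw [measureReal_def, ENNReal.toReal_eq_zero_iff]
      exact Or.inl (ae_iff.1 ((hβ n).and ((hv n).and (hθ n))))
    have h1 := ((hmod n hn).measureReal_not_goodSample_le hn hd1 ha (hX n) (hE n) hu0
      (hug.trans (hgτ.trans hτa))).trans (four_mul_sq_mul_exp_le hD1 hn hcA hDη hT)
    have h2 := ((hmod n hn).measureReal_error_sq_le hn ha (hE n) hτ.le hτa).trans hexpn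
    refine (measureReal_union_le _ _).trans ?_
    rw [h3, add_zero]
    refine (measureReal_union_le _ _).trans ?_
    linarith
  · intro ω hω
    simp only [Set.mem_union, Set.mem_ofPred_eq, not_or, not_not, not_le] at hω
    obtain ⟨⟨hgs, hms⟩, hβω, hvω, hθω⟩ := hω
    obtain ⟨R, hR0, hR1, hR2⟩ := hclose hu0 (hS n hn) (hSv n hn) (hvM n hn) hgs
      (hA₀r.trans hlamn.1) (hA₀r.trans hlamn'.1) (hlamn.2.trans hAr) (hlamn'.2.trans hAr) le_rfl
      (by linarith : 4 * k * g ≤ δ / 2) hcase hβω hvω hθω (hv0 n hn)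
      ((hmod n hn).le_errorVariance ⟨0, hn⟩) hms.le hgτ hkgτ hnkgτ hτ1
      (hτC.trans (min_le_left _ _))
    have hCη : C * τ ≤ η := hτC.trans (min_le_right _ _)
    exact ⟨R, hR0, hR1.trans hCη, hR2.trans hCη⟩
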